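/- **The model.** Let $\alpha\in(0,1)$, $\beta\in(0,1-\alpha)$, $p\in(0,1]$, and let $n,m\ge 1$ be integers. Let $S=[0,1]^m$ carry the uniform distribution and the torus metric $d(x,y)=\min\{\|x-y+u\|_\infty : u\in\{-1,0,1\}^m\}$. The geo-protean process is the following Markov chain. A state consists of $n$ nodes placed in $S$, a ranking (a bijection from the nodes to $\{1,\dots,n\}$) and an undirected graph on the nodes. The influence region of a node of rank $r$ is the $d$-ball around it of volume $r^{-\alpha}n^{-\beta}$. In one time-step: (i) a new node $v$ is placed uniformly at random in $S$, and independently for each present node $u$ whose influence region contains $v$, the edge $uv$ is created with probability $p$; (ii) a node chosen uniformly at random among the $n$ nodes present before the step is deleted together with its edges, and the nodes ranked below it move up by one; (iii) $v$ is inserted into the ranking at rank $R$, where $R\in\{1,\dots,n\}$ is drawn from a prescribed distribution, and the survivors whose current rank is at least $R$ move down by one. The node positions, the edge coins, the deleted node and $R$ are independent, and independent of the past. States are considered with nodes identified by their ranks. The random graph $\mathrm{GEO\text{-}P}(\alpha,\beta,m,p)$ is a random state drawn from the stationary distribution of this chain. Let $S_1=\{x\in S: x_1\le 1/2\}$ and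 $S_2=S\setminus S_1$, and let $e(S_1,S_2)$ be the number of edges with one endpoint in $S_1$ and the other in $S_2$. A sequence of events $A_n$ holds *wep* (with extreme probability) if there is a constant $c>0$ such that $\mathbb P(A_n)\ge 1-\exp(-c\log^2 n)$ for all sufficiently large $n$. **Theorem.** Let $\alpha\in(0,1)$, $\beta\in(0,1-\alpha)$ and $p\in(0,1]$ be constants, let $m=m(n)\ge 1$ be integers, and for each $n\ge1$ let a distribution of the initial rank on $\{1,\dots,n\}$ be prescribed. For every $n\ge 1$ the chain has exactly one stationary distribution, and $\mathrm{GEO\text{-}P}(\alpha,\beta,m,p)$ on $n$ nodes satisfies: 1. If $m=o(\log n)$, then $e(S_1,S_2)=o(n^{2-\alpha-\beta})$ wep; that is, there is a deterministic sequence $\varepsilon_n\to0$ such that wep $e(S_1,S_2)\le \varepsilon_n\, n^{2-\alpha-\beta}$. 2. If $m=(1+o(1))\,C\log n$ for some constant $C>0$, then there is a deterministic sequence $\varepsilon_n\to0$ such that wep $$e(S_1,S_2)\le (1+\varepsilon_n)\,\frac{p}{4(1-\alpha)}\,n^{2-\alpha-\beta}\exp\left(-\frac{\alpha+\beta}{C}\right).$$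 -/

import Mathlib

open MeasureTheory ProbabilityTheory Filter Topology Asymptotics

namespace GeoProtean

/-- The unit hypercube `S = [0,1]^m`; its canonical `volume` is the uniform distribution. -/
abbrev Cube (m : ℕ) : Type := Fin m → unitInterval

/-- The torus metric derived from the sup norm:
`d(x,y) = min { ‖x - y + u‖_∞ : u ∈ {-1,0,1}^m }`. -/
noncomputable def torusDist {m : ℕ} (x y : Cube m) : ℝ :=
  ⨅ u : Fin m → SignType, ‖fun i => (x i : ℝ) - (y i : ℝ) + ((u i : ℤ) : ℝ)‖

/-- The volume `r^{-α} n^{-β}` of the influence region of a node of rank `r`. -/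
noncomputable def influenceVolume (α β : ℝ) (n r : ℕ) : ℝ :=
  (r : ℝ) ^ (-α) * (n : ℝ) ^ (-β)

/-- The ball of volume `V` around `x` in the torus metric. As a ball of radius `ρ ≤ 1/2` is a
translate of a cube with side `2ρ`, its radius is `V^{1/m} / 2`. -/
def torusBall {m : ℕ} (x : Cube m) (V : ℝ) : Set (Cube m) :=
  {y | torusDist x y ≤ V ^ (1 / (m : ℝ)) / 2}

/-- A state of the process with `n` nodes in dimension `m`. A node is identified with its
current rank, the index `k : Fin n` standing for the node of rank `k + 1`; the state records
the position of every node and the graph on the nodes. -/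
abbrev State (n m : ℕ) : Type := (Fin n → Cube m) × SimpleGraph (Fin n)

/-- The random choices of one time-step: the position of the new node, a coin for each node
present before the step, the node (rank) to be deleted and the initial rank of the new node. -/
abbrev Choices (n m : ℕ) : Type := Cube m × (Fin n → Bool) × Fin n × Fin n

/-- The rank (minus one) after the step of the node with rank `k` before it, when the node of
rank `D` dies and the new node gets rank `R`. A survivor's rank drops by one if the deleted
node was above it and then increases by one if the new node is inserted above it. The index `D`
itself is reused for the new node, so its value is `R`. -/
def rankFun {n : ℕ} (D R k : Fin n) : Fin n :=
  if h : k = D then R else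
    ⟨((k : ℕ) - (if D < k then 1 else 0)) +
        (if (R : ℕ) ≤ (k : ℕ) - (if D < k then 1 else 0) then 1 else 0), by
      have h1 := k.isLt
      have h2 := D.isLt
      have h3 : (k : ℕ) ≠ D := fun e => h (Fin.ext e)
      simp only [Fin.lt_def]
      split_ifs <;> omega⟩

theorem rankFun_injective {n : ℕ} (D R : Fin n) : Function.Injective (rankFun D R) := by
  intro a b h
  have ha := a.isLt
  have hb := b.isLt
  by_cases h1 : a = D <;> by_cases h2 : b = D <;>
    simp only [rankFun, h1, h2, dif_pos, dif_neg, not_false_eq_true, Fin.ext_iff,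
      Fin.lt_def] at h ⊢ <;>
    simp only [Fin.ext_iff] at h1 h2 <;> split_ifs at h <;> omega

/-- The update of the ranking as a permutation of the set of ranks. -/
noncomputable def rankUpdate {n : ℕ} (D R : Fin n) : Equiv.Perm (Fin n) :=
  Equiv.ofBijective (rankFun D R) (Finite.injective_iff_bijective.1 (rankFun_injective D R))

/-- The graph after the new node has been linked, at position `v` with coins `coin`, and the node
of rank `D` has been deleted, before the ranks are updated. The label `D` is reused for the new
node, which is adjacent to a survivor `u` if and only if `v` lies in the influence region of `u`
and the coin of `u` shows `true`. -/
def relink {n m : ℕ} (α β : ℝ) (s : State n m) (v : Cube m) (coin : Fin n → Bool) (D : Fin n) :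
    SimpleGraph (Fin n) where
  Adj a b := a ≠ b ∧
    if a = D then v ∈ torusBall (s.1 b) (influenceVolume α β n (b + 1)) ∧ coin b = true
    else if b = D then v ∈ torusBall (s.1 a) (influenceVolume α β n (a + 1)) ∧ coin a = true
    else s.2.Adj a b
  symm := ⟨by
    rintro a b ⟨hne, h⟩
    refine ⟨hne.symm, ?_⟩
    by_cases ha : a = D
    · have hb : b ≠ D := fun hb => hne (ha.trans hb.symm)
      simpa [ha, hb] using h
    · by_cases hb : b = D
      · simpa [ha, hb] using h
      · simpa [ha, hb] using SimpleGraph.Adj.symm (by simpa [ha, hb] using h)⟩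
  loopless := ⟨fun a h => h.1 rfl⟩

/-- One time-step of the process as a function of the old state and the random choices. -/
noncomputable def next {n m : ℕ} (α β : ℝ) (q : State n m × Choices n m) : State n m :=
  let s := q.1
  let v := q.2.1
  let coin := q.2.2.1
  let D := q.2.2.2.1
  let τ := rankUpdate D q.2.2.2.2
  (fun k => Function.update s.1 D v (τ.symm k),
    (relink α β s v coin D).comap τ.symm)

/-- The joint law of the random choices: independently, a uniform point of the cube, coins showing
`true` with probability `p`, a uniformly chosen node to delete, an initial rank with law `ρ`. -/
noncomputable def choiceLaw {n : ℕ} (m : ℕ) (p : unitInterval) (ρ : Measure (Fin n)) :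
    Measure (Choices n m) :=
  (volume : Measure (Cube m)).prod
    ((Measure.pi fun _ : Fin n => bernoulliMeasure true false p).prod
      ((uniformOn (Set.univ : Set (Fin n))).prod ρ))

theorem measurable_torusDist {m : ℕ} :
    Measurable fun q : Cube m × Cube m => torusDist q.1 q.2 := by
  unfold torusDist
  refine Measurable.iInf fun u => Measurable.norm ?_
  fun_prop

theorem measurableSet_torusBall {n m : ℕ} (u : Fin n) (V : ℝ) :
    Measurable fun q : State n m × Cube m => q.2 ∈ torusBall (q.1.1 u) V := by
  have h : Measurable fun q : State n m × Cube m => torusDist (q.1.1 u) q.2 :=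
    measurable_torusDist.comp (f := fun q : State n m × Cube m => (q.1.1 u, q.2)) (by fun_prop)
  have h2 : MeasurableSet {q : State n m × Cube m |
      torusDist (q.1.1 u) q.2 ≤ V ^ (1 / (m : ℝ)) / 2} := measurableSet_le h measurable_const
  exact measurableSet_setOfPred.1 h2

theorem measurable_relink {n m : ℕ} (α β : ℝ) (coin : Fin n → Bool) (D : Fin n) :
    Measurable fun q : State n m × Cube m => relink α β q.1 q.2 coin D := by
  rw [SimpleGraph.measurable_iff_adj]
  intro a b
  have h : Measurable fun q : State n m × Cube m => q.1.2.Adj a b :=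
    SimpleGraph.measurable_iff_adj.1 (measurable_snd.comp measurable_fst) a b
  by_cases ha : a = D
  · simp only [relink, if_pos ha]
    exact measurable_const.and ((measurableSet_torusBall _ _).and measurable_const)
  · by_cases hb : b = D
    · simp only [relink, if_neg ha, if_pos hb]
      exact measurable_const.and ((measurableSet_torusBall _ _).and measurable_const)
    · simp only [relink, if_neg ha, if_neg hb]
      exact measurable_const.and h

theorem measurable_next {n m : ℕ} (α β : ℝ) :
    Measurable (next α β : State n m × Choices n m → State n m) := by
  let f : (State n m × Cube m) × ((Fin n → Bool) × Fin n × Fin n) → State n m :=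
    fun q => next α β (q.1.1, q.1.2, q.2)
  have hf : Measurable f := by
    refine measurable_from_prod_countable_left fun c => ?_
    obtain ⟨coin, D, R⟩ := c
    refine Measurable.prodMk ?_ ?_
    · refine measurable_pi_lambda _ fun k => ?_
      change Measurable fun q : State n m × Cube m =>
        Function.update q.1.1 D q.2 ((rankUpdate D R).symm k)
      by_cases hk : (rankUpdate D R).symm k = D
      · simp only [hk, Function.update_self]
        exact measurable_snd
      · simp only [Function.update_of_ne hk]
        fun_prop
    · rw [SimpleGraph.measurable_iff_adj]
      intro a b
      exact SimpleGraph.measurable_iff_adj.1 (measurable_relink α β coin D)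
        ((rankUpdate D R).symm a) ((rankUpdate D R).symm b)
  exact hf.comp (g := f) (f := fun q : State n m × Choices n m => ((q.1, q.2.1), q.2.2))
    (by fun_prop)

instance {n : ℕ} (m : ℕ) (p : unitInterval) (ρ : Measure (Fin n)) : SFinite (choiceLaw m p ρ) := by
  unfold choiceLaw; infer_instance

/-- The transition kernel of the Markov chain. -/
noncomputable def transition {n : ℕ} (m : ℕ) (α β : ℝ) (p : unitInterval) (ρ : Measure (Fin n)) :
    Kernel (State n m) (State n m) where
  toFun s := (choiceLaw m p ρ).map fun c => next α β (s, c)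
  measurable' := by
    have h : (fun s : State n m => (choiceLaw m p ρ).map fun c => next α β (s, c)) =
        fun s => ((choiceLaw m p ρ).map (Prod.mk s)).map (next α β) := by
      funext s
      rw [Measure.map_map (measurable_next α β) measurable_prodMk_left]
      rfl
    rw [h]
    exact (Measure.measurable_map _ (measurable_next α β)).comp Measurable.map_prodMk_left

/-- `π` is a stationary distribution of the chain, that is, `π` is the law of the geo-protean
graph `GEO-P(α,β,m,p)` on `n` nodes. -/
def IsGeoP {n m : ℕ} (α β : ℝ) (p : unitInterval) (ρ : Measure (Fin n)) (π : Measure (State n m)) : Prop :=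
  IsProbabilityMeasure π ∧ (transition m α β p ρ).Invariant π

/-- The half `S₁ = {x ∈ S : x₁ ≤ 1/2}` of the cube; `S₂` is its complement. -/
def halfCube (m : ℕ) : Set (Cube m) :=
  {x | ∀ h : 0 < m, (x ⟨0, h⟩ : ℝ) ≤ 1 / 2}

/-- The number `e(X,Y)` of edges with one endpoint in each of `X` and `Y`. -/
noncomputable def edgesBetween {V : Type*} (G : SimpleGraph V) (X Y : Set V) : ℕ :=
  {e ∈ G.edgeSet | ∃ x ∈ X, ∃ y ∈ Y, e = s(x, y)}.ncard

/-- The number `e(S₁,S₂)` of edges between the nodes in `S₁` and the nodes in `S₂`. -/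
noncomputable def cutSize {n m : ℕ} (s : State n m) : ℕ :=
  edgesBetween s.2 {k | s.1 k ∈ halfCube m} {k | s.1 k ∉ halfCube m}

/-- The events `A n` hold with extreme probability: with probability at least
`1 - exp(-Θ(log² n))` as `n → ∞`. -/
def WithExtremeProbability {Ω : ℕ → Type*} [∀ n, MeasurableSpace (Ω n)]
    (μ : ∀ n, Measure (Ω n)) (A : ∀ n, Set (Ω n)) : Prop :=
  ∃ c : ℝ, 0 < c ∧ ∀ᶠ n : ℕ in atTop, 1 - Real.exp (-c * Real.log n ^ 2) ≤ (μ n).real (A n)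

end GeoProtean

set_option linter.unusedSectionVars false

namespace GeoProtean

/-! Existence and uniqueness come from a coupling. Two copies of the chain run with the same random
choices can differ only at a set of nodes that loses the deleted node in each step, so its expected
size shrinks by the factor `1 - 1/n` (`AgreeOff.next`, `abs_meanAfter_sub_le`). Hence the laws
converge setwise, uniformly over measurable sets. Replacing a node by a fresh uniform one keeps the
positions independent and uniform, so they are so in the stationary law, whatever the law of the
initial rank (`IsGeoP.map_fst`).

The cut needs no description of the stationary graph, only a balance of loss and gain. In one step
the cut `Y` loses the cut degree of a uniform node, which is `2Y/n` on average, and gains at most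
the cut edges offered to the new node, whose mean `meanGain` depends on the positions alone. In
equilibrium `Y` should therefore not exceed `n/2` times the mean gain by much. Stationarity of the
exponential moment of `Y` turns this into a tail bound: both increments are at most `n`, so for
small `λn` linearizing `exp (λ(G - L))` costs only factors `1 ± λn` (`IsGeoP.integral_drift_le`,
`IsGeoP.measureReal_cutSum_ge_le`).

The mean gain is a sum of functions of independent points. A ball of volume `V` is a cube of side
`V^(1/m)`, and around a uniform centre the volume it has in the other half is on average at most `V
· V^(1/m) / 2` (`volume_crossBall_le`, `integral_crossBound`). The top `δn` ranks carry a share of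
order `δ^(1-α)` of the total volume; the other nodes have small balls, and Hoeffding's inequality
applies to them (`IsGeoP.measureReal_meanGain_gt_le`). As the volumes add up to at most
`n^(1-α-β)/(1-α)`, the mean gain is at most about `p b n^(1-α-β) / (2(1-α))`, with `b` the limit of
the side lengths: `0` if `m = o(log n)` and `exp (-(α+β)/C)` if `m ~ C log n`. The factor `n/2` then
gives the constant `p / (4(1-α))`. -/

/-! ### Coupling of two copies of the chain -/

/-- The states `s` and `s'` agree on the nodes outside `A`. -/
def AgreeOff {n m : ℕ} (A : Finset (Fin n)) (s s' : State n m) : Prop :=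
  (∀ k ∉ A, s.1 k = s'.1 k) ∧ ∀ a ∉ A, ∀ b ∉ A, s.2.Adj a b ↔ s'.2.Adj a b

theorem agreeOff_univ {n m : ℕ} (s s' : State n m) : AgreeOff Finset.univ s s' :=
  ⟨fun k hk => absurd (Finset.mem_univ k) hk, fun k hk => absurd (Finset.mem_univ k) hk⟩

/-- The new node and its links to nodes outside `A` are determined by the common choices, so the
deleted label leaves the set of disagreement and nothing enters it. The remaining labels are only
moved by the ranking. -/
theorem AgreeOff.next {n m : ℕ} {α β : ℝ} {A : Finset (Fin n)} {s s' : State n m}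
    (h : AgreeOff A s s') (c : Choices n m) :
    AgreeOff ((A.erase c.2.2.1).map (rankUpdate c.2.2.1 c.2.2.2).toEmbedding)
      (next α β (s, c)) (next α β (s', c)) := by
  obtain ⟨v, coin, D, R⟩ := c
  have key : ∀ k ∉ (A.erase D).map (rankUpdate D R).toEmbedding,
      (rankUpdate D R).symm k = D ∨ (rankUpdate D R).symm k ∉ A := by
    intro k hk
    by_contra! hc
    exact hk (Finset.mem_map.2 ⟨_, Finset.mem_erase.2 hc, by simp⟩)
  refine ⟨fun k hk => ?_, fun a ha b hb => ?_⟩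
  · change Function.update s.1 D v ((rankUpdate D R).symm k) =
      Function.update s'.1 D v ((rankUpdate D R).symm k)
    by_cases hD : (rankUpdate D R).symm k = D
    · simp [hD]
    · rw [Function.update_of_ne hD, Function.update_of_ne hD]
      exact h.1 _ ((key k hk).resolve_left hD)
  · have ha' := key a ha
    have hb' := key b hb
    change (relink α β s v coin D).Adj ((rankUpdate D R).symm a) ((rankUpdate D R).symm b) ↔
      (relink α β s' v coin D).Adj ((rankUpdate D R).symm a) ((rankUpdate D R).symm b)
    generalize (rankUpdate D R).symm a = a at *
    generalize (rankUpdate D R).symm b = b at *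
    simp only [relink]
    by_cases hab : a = b
    · simp [hab]
    by_cases ha0 : a = D
    · have hb0 : b ∉ A := hb'.resolve_left fun e => hab (ha0.trans e.symm)
      simp [ha0, h.1 b hb0]
    · have ha1 := ha'.resolve_left ha0
      by_cases hb0 : b = D
      · subst hb0
        simp [ha0, h.1 a ha1]
      · simp [ha0, hb0, h.2 a ha1 b (hb'.resolve_left hb0)]

/-! ### Contraction, existence and uniqueness of the stationary law -/

section Contraction

variable {n m : ℕ} [NeZero n]

instance {n : ℕ} [NeZero n] (m : ℕ) (p : unitInterval) (ρ : Measure (Fin n))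
    [IsProbabilityMeasure ρ] : IsProbabilityMeasure (choiceLaw m p ρ) := by
  have : IsProbabilityMeasure (uniformOn (Set.univ : Set (Fin n))) :=
    isProbabilityMeasure_uniformOn Set.finite_univ Set.univ_nonempty
  unfold choiceLaw; infer_instance

instance {n : ℕ} [NeZero n] (m : ℕ) (α β : ℝ) (p : unitInterval) (ρ : Measure (Fin n))
    [IsProbabilityMeasure ρ] : IsMarkovKernel (transition m α β p ρ) :=
  ⟨fun _ => Measure.isProbabilityMeasure_map
    ((measurable_next α β).comp measurable_prodMk_left).aemeasurable⟩

/-- The deleted node is uniformly distributed. -/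
theorem integral_choiceLaw_deleted (m : ℕ) (p : unitInterval) (ρ : Measure (Fin n))
    [IsProbabilityMeasure ρ] (g : Fin n → ℝ) :
    ∫ c, g c.2.2.1 ∂(choiceLaw m p ρ) = (∑ k, g k) / n := by
  have : IsProbabilityMeasure (uniformOn (Set.univ : Set (Fin n))) :=
    isProbabilityMeasure_uniformOn Set.finite_univ Set.univ_nonempty
  have h1 : MeasurePreserving (fun c : Choices n m => c.2.2.1) (choiceLaw m p ρ)
      (uniformOn (Set.univ : Set (Fin n))) := by
    unfold choiceLaw
    exact measurePreserving_fst.comp (measurePreserving_snd.comp measurePreserving_snd)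
  have h2 := integral_map (μ := choiceLaw m p ρ) h1.measurable.aemeasurable
    (f := g) (by fun_prop)
  rw [← h2, h1.map_eq, integral_fintype (.of_finite), Finset.sum_div]
  refine Finset.sum_congr rfl fun k _ => ?_
  simp [measureReal_def, uniformOn_univ, div_eq_inv_mul]

/-- The mean of `f` after one step. -/
noncomputable def meanAfter (α β : ℝ) (p : unitInterval) (ρ : Measure (Fin n))
    (f : State n m → ℝ) (s : State n m) : ℝ :=
  ∫ c, f (next α β (s, c)) ∂(choiceLaw m p ρ)

variable {α β : ℝ} {p : unitInterval} {ρ : Measure (Fin n)} [IsProbabilityMeasure ρ]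

theorem measurable_meanAfter {f : State n m → ℝ} (hf : Measurable f) :
    Measurable (meanAfter α β p ρ f) := by
  have : StronglyMeasurable fun q : State n m × Choices n m => f (next α β q) :=
    (hf.comp (measurable_next α β)).stronglyMeasurable
  exact this.integral_prod_right.measurable

theorem integrable_of_mem_Icc {Ω : Type*} [MeasurableSpace Ω] {μ : Measure Ω} [IsFiniteMeasure μ]
    {f : Ω → ℝ} {a b : ℝ} (hf : Measurable f) (h : ∀ x, f x ∈ Set.Icc a b) : Integrable f μ :=
  Integrable.of_mem_Icc a b hf.aemeasurable (.of_forall h)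

theorem measurable_next_right (s : State n m) :
    Measurable fun c : Choices n m => next α β (s, c) :=
  (measurable_next α β).comp measurable_prodMk_left

theorem meanAfter_mem_Icc {f : State n m → ℝ} (hf : Measurable f)
    {a b : ℝ} (h : ∀ s, f s ∈ Set.Icc a b) (s : State n m) :
    meanAfter α β p ρ f s ∈ Set.Icc a b := by
  have hi : Integrable (fun c => f (next α β (s, c))) (choiceLaw m p ρ) :=
    integrable_of_mem_Icc (hf.comp (measurable_next_right s)) fun _ => h _
  constructor
  · simpa [meanAfter] using integral_mono (integrable_const a) hi fun c => (h _).1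
  · simpa [meanAfter] using integral_mono hi (integrable_const b) fun c => (h _).2

theorem bind_transition (μ : Measure (State n m)) [IsProbabilityMeasure μ] :
    μ.bind (transition m α β p ρ) = (μ.prod (choiceLaw m p ρ)).map (next α β) := by
  refine Measure.ext fun B hB => ?_
  rw [Measure.bind_apply hB (transition m α β p ρ).aemeasurable,
    Measure.map_apply (measurable_next α β) hB, Measure.prod_apply (measurable_next α β hB)]
  refine lintegral_congr fun s => ?_
  exact Measure.map_apply (measurable_next_right s) hB

theorem integral_bind_transition {f : State n m → ℝ} (hf : Measurable f)
    {a b : ℝ} (h : ∀ s, f s ∈ Set.Icc a b) (μ : Measure (State n m)) [IsProbabilityMeasure μ] :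
    ∫ s, f s ∂(μ.bind (transition m α β p ρ)) = ∫ s, meanAfter α β p ρ f s ∂μ := by
  rw [bind_transition, integral_map (measurable_next α β).aemeasurable hf.aestronglyMeasurable]
  exact integral_prod _ (integrable_of_mem_Icc (hf.comp (measurable_next α β)) fun _ => h _)

/-- One step contracts the Lipschitz constant of `f` with respect to the number of nodes at which
two states differ. -/
theorem abs_meanAfter_sub_le {f : State n m → ℝ} (hf : Measurable f)
    {a b : ℝ} (h : ∀ s, f s ∈ Set.Icc a b) {κ : ℝ}
    (hκ : ∀ A s s', AgreeOff A s s' → |f s - f s'| ≤ κ * A.card)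
    {A : Finset (Fin n)} {s s' : State n m} (hA : AgreeOff A s s') :
    |meanAfter α β p ρ f s - meanAfter α β p ρ f s'| ≤ κ * (1 - 1 / n) * A.card := by
  have hi : ∀ s, Integrable (fun c => f (next α β (s, c))) (choiceLaw m p ρ) := fun s =>
    integrable_of_mem_Icc (hf.comp (measurable_next_right s)) fun _ => h _
  have hn : (n : ℝ) ≠ 0 := Nat.cast_ne_zero.2 (NeZero.ne n)
  unfold meanAfter
  rw [← integral_sub (hi s) (hi s')]
  calc _ ≤ ∫ c, |f (next α β (s, c)) - f (next α β (s', c))| ∂(choiceLaw m p ρ) :=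
        abs_integral_le_integral_abs
    _ ≤ ∫ c : Choices n m, κ * ((A.erase c.2.2.1).card : ℝ) ∂(choiceLaw m p ρ) := by
        refine integral_mono ((hi s).sub (hi s')).abs ?_ fun c => ?_
        · refine integrable_of_mem_Icc (a := -(|κ| * n)) (b := |κ| * n) ?_ fun c => ?_
          · exact (measurable_of_finite fun k => κ * ((A.erase k).card : ℝ)).comp
              (f := fun c : Choices n m => c.2.2.1) (by fun_prop)
          · rw [Set.mem_Icc, ← abs_le, abs_mul]
            gcongr
            rw [Nat.abs_cast]
            exact_mod_cast (Finset.card_le_univ _).trans (by simp)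
        · have := hκ _ _ _ (hA.next (α := α) (β := β) c)
          rwa [Finset.card_map] at this
    -- The uniform deleted node lies in `A` with probability `|A|/n`.
    _ = κ * (1 - 1 / n) * A.card := by
        rw [integral_choiceLaw_deleted m p ρ fun k => κ * ((A.erase k).card : ℝ), ← Finset.mul_sum]
        have : ∀ k, ((A.erase k).card : ℝ) = A.card - if k ∈ A then 1 else 0 := by
          intro k
          by_cases hk : k ∈ A
          · have := Finset.card_erase_add_one hk
            rw [← this]; simp [hk]
          · simp [hk]
        simp_rw [this]
        simp [Finset.sum_sub_distrib]
        field_simp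

theorem abs_integral_sub_le_of_abs_sub_le {Ω : Type*} [MeasurableSpace Ω] {f : Ω → ℝ} {a b ε : ℝ}
    (hf : Measurable f) (h : ∀ s, f s ∈ Set.Icc a b) (hε : ∀ s s', |f s - f s'| ≤ ε)
    (μ ν : Measure Ω) [IsProbabilityMeasure μ] [IsProbabilityMeasure ν] :
    |∫ s, f s ∂μ - ∫ s, f s ∂ν| ≤ ε := by
  have hi : ∀ μ : Measure Ω, IsProbabilityMeasure μ → Integrable f μ := fun μ _ =>
    integrable_of_mem_Icc hf h
  have h1 : ∀ s', |∫ s, f s ∂μ - f s'| ≤ ε := fun s' => by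
    have := integral_sub (hi μ inferInstance) (integrable_const (μ := μ) (f s'))
    rw [integral_const, probReal_univ, one_smul] at this
    rw [← this]
    refine abs_integral_le_integral_abs.trans ?_
    have := integral_mono (((hi μ inferInstance).sub (integrable_const (f s'))).abs)
      (integrable_const ε) (fun s => hε s s')
    simpa using this
  have := integral_sub (integrable_const (μ := ν) (∫ s, f s ∂μ)) (hi ν inferInstance)
  rw [integral_const, probReal_univ, one_smul] at this
  rw [← this]
  refine abs_integral_le_integral_abs.trans ?_
  have := integral_mono (((integrable_const (∫ s, f s ∂μ)).sub (hi ν inferInstance)).abs)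
    (integrable_const ε) (fun s => h1 s)
  simpa using this

/-- The law of the state after `t` steps from the law `μ`. -/
noncomputable def lawAfter (α β : ℝ) (p : unitInterval) (ρ : Measure (Fin n))
    (μ : Measure (State n m)) (t : ℕ) : Measure (State n m) :=
  (fun ν => ν.bind (transition m α β p ρ))^[t] μ

theorem lawAfter_succ (μ : Measure (State n m)) (t : ℕ) :
    lawAfter α β p ρ μ (t + 1) = (lawAfter α β p ρ μ t).bind (transition m α β p ρ) :=
  Function.iterate_succ_apply' _ _ _

theorem lawAfter_add (μ : Measure (State n m)) (t r : ℕ) :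
    lawAfter α β p ρ μ (t + r) = lawAfter α β p ρ (lawAfter α β p ρ μ r) t :=
  Function.iterate_add_apply _ _ _ _

instance (μ : Measure (State n m)) [IsProbabilityMeasure μ] (t : ℕ) :
    IsProbabilityMeasure (lawAfter α β p ρ μ t) := by
  induction t with
  | zero => simpa [lawAfter]
  | succ t ih => rw [lawAfter_succ]; infer_instance

/-- The coupling in dual form: each step is moved from the laws onto the test function, whose
Lipschitz constant contracts. The induction therefore runs over all test functions at once, and no
coupled chain has to be built. -/
theorem abs_integral_lawAfter_sub_le (μ ν : Measure (State n m))
    [IsProbabilityMeasure μ] [IsProbabilityMeasure ν] (t : ℕ) :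
    ∀ (f : State n m → ℝ) (_ : Measurable f) (_ : ∀ s, f s ∈ Set.Icc (0 : ℝ) 1) (κ : ℝ)
      (_ : ∀ A s s', AgreeOff A s s' → |f s - f s'| ≤ κ * A.card),
    |∫ s, f s ∂(lawAfter α β p ρ μ t) - ∫ s, f s ∂(lawAfter α β p ρ ν t)| ≤
      κ * (1 - 1 / n) ^ t * n := by
  induction t with
  | zero =>
    intro f hf h κ hκ
    refine abs_integral_sub_le_of_abs_sub_le hf h (fun s s' => ?_) μ ν
    simpa using hκ _ _ _ (agreeOff_univ s s')
  | succ t ih =>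
    intro f hf h κ hκ
    rw [lawAfter_succ, lawAfter_succ, integral_bind_transition hf h, integral_bind_transition hf h]
    refine (ih _ (measurable_meanAfter hf) (meanAfter_mem_Icc hf h) (κ * (1 - 1 / n))
      fun A s s' hA => abs_meanAfter_sub_le hf h hκ hA).trans (le_of_eq ?_)
    ring

/-- An indicator is Lipschitz with constant `1`, since distinct states disagree at one node at
least. The bound does not depend on the set. -/
theorem abs_measureReal_lawAfter_sub_le (μ ν : Measure (State n m))
    [IsProbabilityMeasure μ] [IsProbabilityMeasure ν] (t : ℕ) {B : Set (State n m)}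
    (hB : MeasurableSet B) :
    |(lawAfter α β p ρ μ t).real B - (lawAfter α β p ρ ν t).real B| ≤ (1 - 1 / n) ^ t * n := by
  have h01 : ∀ s, B.indicator (1 : State n m → ℝ) s ∈ Set.Icc (0 : ℝ) 1 := fun s => by
    by_cases hs : s ∈ B <;> simp [hs]
  have := abs_integral_lawAfter_sub_le (α := α) (β := β) (p := p) (ρ := ρ) μ ν t
    (B.indicator 1) (measurable_one.indicator hB) h01 1 ?_
  · simpa [integral_indicator_one hB] using this
  · intro A s s' hA
    rcases A.eq_empty_or_nonempty with rfl | hne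
    · have : s = s' := by
        refine Prod.ext (funext fun k => hA.1 k (by simp)) ?_
        ext a b
        exact hA.2 a (by simp) b (by simp)
      simp [this]
    · have hc : (1 : ℝ) ≤ A.card := by exact_mod_cast hne.card_pos
      rw [one_mul]
      refine le_trans ?_ hc
      have h1 := h01 s
      have h2 := h01 s'
      rw [abs_le]
      constructor <;> linarith [h1.1, h1.2, h2.1, h2.2]

theorem tendsto_contraction (n : ℕ) [NeZero n] :
    Tendsto (fun t : ℕ => (1 - 1 / (n : ℝ)) ^ t * n) atTop (𝓝 0) := by
  have hn : (1 : ℝ) ≤ n := by exact_mod_cast NeZero.one_le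
  have h1 : (0 : ℝ) ≤ 1 - 1 / n := by
    rw [sub_nonneg, div_le_one (by linarith)]; exact hn
  have h2 : 1 - 1 / (n : ℝ) < 1 := by
    have : 0 < 1 / (n : ℝ) := by positivity
    linarith
  simpa using (tendsto_pow_atTop_nhds_zero_of_lt_one h1 h2).mul_const (n : ℝ)

theorem lawAfter_eq_of_invariant {π : Measure (State n m)}
    (h : (transition m α β p ρ).Invariant π) (t : ℕ) : lawAfter α β p ρ π t = π := by
  induction t with
  | zero => rfl
  | succ t ih => rw [lawAfter_succ, ih]; exact h

theorem tendsto_lawAfter_of_isGeoP {π : Measure (State n m)} (h : IsGeoP α β p ρ π)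
    (μ : Measure (State n m)) [IsProbabilityMeasure μ] {B : Set (State n m)}
    (hB : MeasurableSet B) :
    Tendsto (fun t => (lawAfter α β p ρ μ t).real B) atTop (𝓝 (π.real B)) := by
  have := h.1
  rw [tendsto_iff_dist_tendsto_zero]
  refine squeeze_zero (fun _ => dist_nonneg) (fun t => ?_) (tendsto_contraction n)
  have := abs_measureReal_lawAfter_sub_le (α := α) (β := β) (p := p) (ρ := ρ) μ π t hB
  rwa [lawAfter_eq_of_invariant h.2, ← Real.dist_eq] at this

theorem IsGeoP.unique {π π' : Measure (State n m)} (h : IsGeoP α β p ρ π)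
    (h' : IsGeoP α β p ρ π') : π = π' := by
  have := h.1
  have := h'.1
  refine Measure.ext fun B hB => ?_
  have := tendsto_nhds_unique (tendsto_lawAfter_of_isGeoP h π' hB)
    (tendsto_lawAfter_of_isGeoP h' π' hB)
  exact (measureReal_eq_measureReal_iff).1 this

/-- Setwise limits are finitely additive for free; the rate `r`, uniform in the set, is what carries
countable additivity over to the limit. -/
theorem exists_limit_of_uniform_cauchy {Ω : Type*} [MeasurableSpace Ω] {μ : ℕ → Measure Ω}
    [∀ t, IsProbabilityMeasure (μ t)] {r : ℕ → ℝ} (hr : Tendsto r atTop (𝓝 0))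
    (h : ∀ t k B, MeasurableSet B → |(μ (t + k)).real B - (μ t).real B| ≤ r t) :
    ∃ Q : Measure Ω, IsProbabilityMeasure Q ∧
      ∀ B, MeasurableSet B → Tendsto (fun t => (μ t).real B) atTop (𝓝 (Q.real B)) := by
  have hex : ∀ B, ∃ l, MeasurableSet B → Tendsto (fun t => (μ t).real B) atTop (𝓝 l) := by
    intro B
    by_cases hB : MeasurableSet B
    · have : CauchySeq fun t => (μ t).real B := by
        refine cauchySeq_of_le_tendsto_0' r (fun t u htu => ?_) hr
        obtain ⟨k, rfl⟩ := Nat.exists_eq_add_of_le htu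
        rw [dist_comm]
        exact h t k B hB
      obtain ⟨l, hl⟩ := cauchySeq_tendsto_of_complete this
      exact ⟨l, fun _ => hl⟩
    · exact ⟨0, fun h => absurd h hB⟩
  choose l hl using hex
  have hl0 : ∀ B, MeasurableSet B → 0 ≤ l B := fun B hB =>
    ge_of_tendsto' (hl B hB) fun t => measureReal_nonneg
  -- Let `k → ∞` in the Cauchy bound.
  have hle : ∀ t B, MeasurableSet B → |l B - (μ t).real B| ≤ r t := fun t B hB =>
    le_of_tendsto' (((hl B hB).comp (tendsto_atTop_mono (fun k => Nat.le_add_left k t)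
      tendsto_id)).sub_const ((μ t).real B)).abs fun k => h t k B hB
  have hsum : ∀ f : ℕ → Set Ω, (∀ i, MeasurableSet (f i)) →
      Pairwise (Function.onFun Disjoint f) → HasSum (fun i => l (f i)) (l (⋃ i, f i)) := by
    intro f hf hd
    have hU := MeasurableSet.iUnion hf
    rw [hasSum_iff_tendsto_nat_of_nonneg fun i => hl0 _ (hf i)]
    have hfin : ∀ N, ∑ i ∈ Finset.range N, l (f i) = l (⋃ i ∈ Finset.range N, f i) := by
      intro N
      refine tendsto_nhds_unique (tendsto_finsetSum _ fun i _ => hl (f i) (hf i))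
        ((hl _ (Finset.measurableSet_biUnion _ fun i _ => hf i)).congr fun t => ?_)
      exact measureReal_biUnion_finset (fun i _ j _ hij => hd hij) fun i _ => hf i
    rw [Metric.tendsto_atTop]
    intro ε hε
    -- A single time `t` serves the full union and all its finite parts, so only the continuity of
    -- the one measure `μ t` is needed.
    obtain ⟨t, ht⟩ := (hr.eventually (gt_mem_nhds (show 0 < ε / 3 by linarith))).exists
    have hμ : Tendsto (fun N => (μ t).real (⋃ i ∈ Finset.range N, f i)) atTop
        (𝓝 ((μ t).real (⋃ i, f i))) := by
      have h1 : HasSum (fun i => (μ t).real (f i)) ((μ t).real (⋃ i, f i)) := by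
        have h2 := measure_iUnion (μ := μ t) hd hf
        rw [measureReal_def, h2, ENNReal.tsum_toReal_eq fun i => measure_ne_top _ _]
        exact ENNReal.hasSum_toReal (by rw [← h2]; exact measure_ne_top _ _)
      refine h1.tendsto_sum_nat.congr fun N => ?_
      exact (measureReal_biUnion_finset (fun i _ j _ hij => hd hij) fun i _ => hf i).symm
    obtain ⟨N, hN⟩ := Metric.tendsto_atTop.1 hμ (ε / 3) (by linarith)
    refine ⟨N, fun k hk => ?_⟩
    have h1 := hN k hk
    have h2 := hle t _ (Finset.measurableSet_biUnion (Finset.range k) fun i _ => hf i)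
    have h3 := hle t _ hU
    rw [hfin, Real.dist_eq]
    rw [Real.dist_eq] at h1
    rw [abs_lt] at h1 ⊢
    rw [abs_le] at h2 h3
    constructor <;> linarith [h1.1, h1.2, h2.1, h2.2, h3.1, h3.2]
  have hempty : l ∅ = 0 := tendsto_nhds_unique (hl ∅ .empty) (by simp)
  have huniv : l Set.univ = 1 := tendsto_nhds_unique (hl _ .univ) (by simp)
  let Q : Measure Ω := Measure.ofMeasurable (fun B _ => ENNReal.ofReal (l B)) (by simp [hempty])
    fun f hf hd => by
      have := hsum f hf hd
      rw [← this.tsum_eq, ENNReal.ofReal_tsum_of_nonneg (fun i => hl0 _ (hf i)) this.summable]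
  have hQ : ∀ B, MeasurableSet B → Q B = ENNReal.ofReal (l B) := fun B hB =>
    Measure.ofMeasurable_apply B hB
  refine ⟨Q, ⟨by rw [hQ _ .univ, huniv, ENNReal.ofReal_one]⟩, fun B hB => ?_⟩
  rw [measureReal_def, hQ B hB, ENNReal.toReal_ofReal (hl0 B hB)]
  exact hl B hB

/-- The layer-cake formula writes the integral as that of the measures of superlevel sets over
`(0,1]`; these converge pointwise and are bounded by one. -/
theorem tendsto_integral_of_tendsto_measureReal {Ω : Type*} [MeasurableSpace Ω]
    {μ : ℕ → Measure Ω} [∀ t, IsProbabilityMeasure (μ t)] {Q : Measure Ω} [IsProbabilityMeasure Q]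
    (h : ∀ B, MeasurableSet B → Tendsto (fun t => (μ t).real B) atTop (𝓝 (Q.real B)))
    {f : Ω → ℝ} (hf : Measurable f) (h01 : ∀ x, f x ∈ Set.Icc (0 : ℝ) 1) :
    Tendsto (fun t => ∫ x, f x ∂(μ t)) atTop (𝓝 (∫ x, f x ∂Q)) := by
  have key : ∀ ν : Measure Ω, IsProbabilityMeasure ν →
      ∫ x, f x ∂ν = ∫ u in Set.Ioc 0 1, ν.real {x | u ≤ f x} := fun ν _ =>
    (integrable_of_mem_Icc hf h01).integral_eq_integral_Ioc_meas_le
      (.of_forall fun x => (h01 x).1) (.of_forall fun x => (h01 x).2)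
  rw [key Q inferInstance]
  simp_rw [fun t => key (μ t) inferInstance]
  refine tendsto_integral_of_dominated_convergence (fun _ => 1) (fun t => ?_)
    (integrable_const _) (fun t => .of_forall fun u => ?_)
    (.of_forall fun u => h _ (measurableSet_le measurable_const hf))
  · have : Antitone fun u => (μ t).real {x | u ≤ f x} := fun u v huv =>
      measureReal_mono fun x hx => huv.trans hx
    exact this.measurable.aestronglyMeasurable
  · rw [Real.norm_of_nonneg measureReal_nonneg]
    exact measureReal_le_one

/-- The distribution of independent uniform nodes without edges. -/
noncomputable def edgelessLaw (n m : ℕ) : Measure (State n m) :=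
  (volume : Measure (Fin n → Cube m)).prod (Measure.dirac ⊥)

instance (n m : ℕ) : IsProbabilityMeasure (edgelessLaw n m) := by
  unfold edgelessLaw; infer_instance

/-- The law after `t + k` steps is the law after `t` steps from another start, so contraction gives
the uniform Cauchy property. The limit is stationary because the laws at times `t` and `t + 1` share
it and one step is continuous under setwise convergence. -/
theorem exists_isGeoP (α β : ℝ) (p : unitInterval) (ρ : Measure (Fin n)) [IsProbabilityMeasure ρ] :
    ∃ π : Measure (State n m), IsGeoP α β p ρ π := by
  obtain ⟨Q, hQ, hlim⟩ := exists_limit_of_uniform_cauchy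
    (μ := lawAfter α β p ρ (edgelessLaw n m)) (tendsto_contraction n) fun t k B hB => by
      rw [lawAfter_add]
      exact abs_measureReal_lawAfter_sub_le _ _ t hB
  refine ⟨Q, hQ, Measure.ext fun B hB => ?_⟩
  have h01 : ∀ s, B.indicator (1 : State n m → ℝ) s ∈ Set.Icc (0 : ℝ) 1 := fun s => by
    by_cases hs : s ∈ B <;> simp [hs]
  have hm : Measurable (B.indicator (1 : State n m → ℝ)) := measurable_one.indicator hB
  have h1 := tendsto_integral_of_tendsto_measureReal hlim
    (measurable_meanAfter (α := α) (β := β) (p := p) (ρ := ρ) hm) (meanAfter_mem_Icc hm h01)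
  simp_rw [← integral_bind_transition hm h01, ← lawAfter_succ, integral_indicator_one hB] at h1
  exact (measureReal_eq_measureReal_iff).1
    (tendsto_nhds_unique h1 ((hlim B hB).comp (tendsto_add_atTop_nat 1)))

end Contraction

/-! ### Independence and uniformity of the positions -/

/-- Replacing one of finitely many independent points by a fresh one and permuting the points
preserves their joint law. -/
theorem measurePreserving_update_comp {ι X : Type*} [Fintype ι] [DecidableEq ι]
    [MeasurableSpace X] (μ : Measure X) [IsProbabilityMeasure μ] (D : ι) (τ : Equiv.Perm ι) :
    MeasurePreserving (fun q : (ι → X) × X => fun k => Function.update q.1 D q.2 (τ.symm k))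
      ((Measure.pi fun _ => μ).prod μ) (Measure.pi fun _ => μ) := by
  have hm : Measurable fun q : (ι → X) × X => fun k => Function.update q.1 D q.2 (τ.symm k) := by
    refine measurable_pi_lambda _ fun k => ?_
    by_cases hk : τ.symm k = D
    · simpa [hk] using measurable_snd
    · simp only [Function.update_of_ne hk]
      fun_prop
  refine ⟨hm, (Measure.pi_eq fun s hs => ?_).symm⟩
  rw [Measure.map_apply hm (MeasurableSet.univ_pi hs)]
  -- The preimage of a box is a box: the old point at `D` is free, and the fresh point takes over
  -- the constraint at `τ D`.
  have : (fun q : (ι → X) × X => fun k => Function.update q.1 D q.2 (τ.symm k)) ⁻¹'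
      Set.univ.pi s = (Set.univ.pi (Function.update (s ∘ τ) D Set.univ)) ×ˢ s (τ D) := by
    ext ⟨x, v⟩
    simp only [Set.mem_preimage, Set.mem_pi, Set.mem_univ, true_imp_iff, Set.mem_prod]
    constructor
    · intro h
      refine ⟨fun k => ?_, by simpa using h (τ D)⟩
      by_cases hk : k = D
      · subst hk; simp
      · simpa [hk] using h (τ k)
    · rintro ⟨h1, h2⟩ k
      by_cases hk : τ.symm k = D
      · obtain rfl : k = τ D := by rw [← hk]; simp
        simpa using h2
      · simpa [hk] using h1 (τ.symm k)
  rw [this, Measure.prod_prod, Measure.pi_pi, ← Equiv.prod_comp τ fun k => μ (s k),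
    ← Finset.prod_erase_mul _ (fun k => μ (s (τ k))) (Finset.mem_univ D),
    ← Finset.prod_erase_mul _ (fun k => μ (Function.update (s ∘ τ) D Set.univ k))
      (Finset.mem_univ D), Function.update_self, measure_univ, mul_one]
  congr 1
  refine Finset.prod_congr rfl fun k hk => ?_
  rw [Function.update_of_ne (Finset.ne_of_mem_erase hk)]
  rfl

section Positions

variable {n m : ℕ} [NeZero n] {α β : ℝ} {p : unitInterval} {ρ : Measure (Fin n)}
  [IsProbabilityMeasure ρ]

/-- For fixed coins, `D` and `R` the update of the positions preserves the product measure, and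
these choices are independent of the old positions and the fresh point. -/
theorem map_fst_bind_transition {μ : Measure (State n m)} [IsProbabilityMeasure μ]
    (h : μ.map Prod.fst = volume) :
    (μ.bind (transition m α β p ρ)).map Prod.fst = volume := by
  have : IsProbabilityMeasure (uniformOn (Set.univ : Set (Fin n))) :=
    isProbabilityMeasure_uniformOn Set.finite_univ Set.univ_nonempty
  let ζ : Measure ((Fin n → Bool) × Fin n × Fin n) :=
    (Measure.pi fun _ : Fin n => bernoulliMeasure true false p).prod
      ((uniformOn (Set.univ : Set (Fin n))).prod ρ)
  let g : (Fin n → Bool) × Fin n × Fin n → (Fin n → Cube m) × Cube m → (Fin n → Cube m) :=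
    fun r q k => Function.update q.1 r.2.1 q.2 ((rankUpdate r.2.1 r.2.2).symm k)
  have hg : ∀ r, MeasurePreserving (g r) ((volume : Measure (Fin n → Cube m)).prod volume)
      volume := fun r => measurePreserving_update_comp volume r.2.1 (rankUpdate r.2.1 r.2.2)
  have hgm : Measurable (Function.uncurry g) :=
    measurable_from_prod_countable_right fun r => (hg r).measurable
  have h1 : MeasurePreserving
      (fun q : ((Fin n → Bool) × Fin n × Fin n) × (Fin n → Cube m) × Cube m => g q.1 q.2)
      (ζ.prod ((volume : Measure (Fin n → Cube m)).prod (volume : Measure (Cube m)))) volume :=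
    measurePreserving_snd.comp ((MeasurePreserving.id ζ).skew_product hgm
      (.of_forall fun r => (hg r).map_eq))
  have h2 : MeasurePreserving (Prod.fst : State n m → _) μ volume := ⟨measurable_fst, h⟩
  have h3 : MeasurePreserving (fun q : State n m × Choices n m => (q.1.1, q.2))
      (μ.prod (choiceLaw m p ρ)) (volume.prod (choiceLaw m p ρ)) :=
    h2.prod (.id (choiceLaw m p ρ))
  have h4 : MeasurePreserving
      (fun q : (Fin n → Cube m) × Choices n m => ((q.1, q.2.1), q.2.2))
      ((volume : Measure (Fin n → Cube m)).prod (choiceLaw m p ρ))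
      ((volume.prod (volume : Measure (Cube m))).prod ζ) :=
    (measurePreserving_prodAssoc _ _ _).symm
  have h5 := h1.comp (Measure.measurePreserving_swap.comp (h4.comp h3))
  rw [bind_transition, Measure.map_map measurable_fst (measurable_next α β)]
  exact h5.map_eq

/-- In the stationary distribution the nodes are independent and uniform. -/
theorem IsGeoP.map_fst {π : Measure (State n m)} (h : IsGeoP α β p ρ π) :
    π.map Prod.fst = volume := by
  have := h.1
  -- The edgeless start has independent uniform positions; this survives every step and then the
  -- setwise limit.
  have hlaw : ∀ t, (lawAfter α β p ρ (edgelessLaw n m) t).map Prod.fst = volume := by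
    intro t
    induction t with
    | zero => exact measurePreserving_fst.map_eq
    | succ t ih => rw [lawAfter_succ]; exact map_fst_bind_transition ih
  refine Measure.ext fun B hB => ?_
  have h1 := tendsto_lawAfter_of_isGeoP h (edgelessLaw n m) (measurable_fst hB)
  rw [Measure.map_apply measurable_fst hB]
  refine (measureReal_eq_measureReal_iff).1 (tendsto_nhds_unique h1 ?_)
  refine tendsto_const_nhds.congr fun t => ?_
  rw [← hlaw t, map_measureReal_apply measurable_fst hB]

end Positions

/-! ### The cut and its change in one step -/

section Cut

variable {n m : ℕ}

open Classical in
/-- Indicator of an edge from the node `a` in the half cube to the node `b` outside of it. -/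
noncomputable def cutIndicator (s : State n m) (a b : Fin n) : ℝ :=
  if s.1 a ∈ halfCube m ∧ s.1 b ∉ halfCube m ∧ s.2.Adj a b then 1 else 0

/-- The size of the cut as a sum over ordered pairs. -/
noncomputable def cutSum (s : State n m) : ℝ := ∑ a, ∑ b, cutIndicator s a b

/-- The number of cut edges at the node `D`. -/
noncomputable def cutDegree (s : State n m) (D : Fin n) : ℝ :=
  ∑ b, (cutIndicator s D b + cutIndicator s b D)

/-- The points of the ball of volume `V` around `x` that lie in the other half of the cube. -/
def crossBall (x : Cube m) (V : ℝ) : Set (Cube m) :=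
  {v | v ∈ torusBall x V ∧ ¬(x ∈ halfCube m ↔ v ∈ halfCube m)}

open Classical in
/-- The number of cut edges offered to a new node at `v`. -/
noncomputable def cutGain (α β : ℝ) (s : State n m) (v : Cube m) (coin : Fin n → Bool) : ℝ :=
  ∑ b : Fin n, if v ∈ crossBall (s.1 b) (influenceVolume α β n (b + 1)) ∧ coin b = true
    then 1 else 0

theorem cutSize_le_cutSum (s : State n m) : (cutSize s : ℝ) ≤ cutSum s := by
  classical
  let P : Finset (Fin n × Fin n) := Finset.univ.filter fun q =>
    s.1 q.1 ∈ halfCube m ∧ s.1 q.2 ∉ halfCube m ∧ s.2.Adj q.1 q.2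
  have h1 : cutSum s = P.card := by
    rw [cutSum, ← Fintype.sum_prod_type', Finset.card_filter]
    push_cast
    rfl
  rw [h1]
  norm_cast
  have h2 : {e ∈ s.2.edgeSet | ∃ x ∈ {k | s.1 k ∈ halfCube m}, ∃ y ∈ {k | s.1 k ∉ halfCube m},
      e = s(x, y)} ⊆ (P.image fun q => s(q.1, q.2) : Finset (Sym2 (Fin n))) := by
    rintro e ⟨he, x, hx, y, hy, rfl⟩
    exact Finset.mem_coe.2 (Finset.mem_image.2
      ⟨(x, y), Finset.mem_filter.2 ⟨Finset.mem_univ _, hx, hy, he⟩, rfl⟩)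
  calc cutSize s ≤ ((P.image fun q => s(q.1, q.2) : Finset (Sym2 (Fin n))) :
        Set (Sym2 (Fin n))).ncard := Set.ncard_le_ncard h2
    _ ≤ P.card := by rw [Set.ncard_coe_finset]; exact Finset.card_image_le

theorem cutIndicator_nonneg (s : State n m) (a b : Fin n) : 0 ≤ cutIndicator s a b := by
  unfold cutIndicator; split_ifs <;> norm_num

/-- At most one orientation leads from the half cube out of it. This keeps cut degrees at most `n`,
the increment bound behind the choice of `lam`. -/
theorem cutIndicator_add_swap_le (s : State n m) (a b : Fin n) :
    cutIndicator s a b + cutIndicator s b a ≤ 1 := by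
  unfold cutIndicator
  by_cases ha : s.1 a ∈ halfCube m <;> by_cases hb : s.1 b ∈ halfCube m <;>
    simp only [ha, hb, not_true, not_false_eq_true, true_and, false_and, if_false] <;>
    first | (split_ifs <;> norm_num) | norm_num

theorem cutDegree_nonneg (s : State n m) (D : Fin n) : 0 ≤ cutDegree s D :=
  Finset.sum_nonneg fun _ _ => add_nonneg (cutIndicator_nonneg _ _ _) (cutIndicator_nonneg _ _ _)

theorem cutDegree_le (s : State n m) (D : Fin n) : cutDegree s D ≤ n := by
  simpa [cutDegree] using
    Finset.sum_le_sum fun (b : Fin n) (_ : b ∈ Finset.univ) => cutIndicator_add_swap_le s D b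

theorem sum_cutDegree (s : State n m) : ∑ D, cutDegree s D = 2 * cutSum s := by
  simp only [cutDegree, Finset.sum_add_distrib]
  rw [Finset.sum_comm (f := fun D b => cutIndicator s b D), two_mul]
  rfl

theorem cutSum_nonneg (s : State n m) : 0 ≤ cutSum s :=
  Finset.sum_nonneg fun _ _ => Finset.sum_nonneg fun _ _ => cutIndicator_nonneg _ _ _

theorem cutSum_le (s : State n m) : cutSum s ≤ (n : ℝ) ^ 2 := by
  have h1 : ∀ a b, cutIndicator s a b ≤ 1 := fun a b => by
    linarith [cutIndicator_add_swap_le s a b, cutIndicator_nonneg s b a]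
  calc cutSum s ≤ ∑ _a : Fin n, ∑ _b : Fin n, (1 : ℝ) :=
        Finset.sum_le_sum fun a _ => Finset.sum_le_sum fun b _ => h1 a b
    _ = (n : ℝ) ^ 2 := by simp [sq]

theorem cutGain_nonneg (α β : ℝ) (s : State n m) (v : Cube m) (coin : Fin n → Bool) :
    0 ≤ cutGain α β s v coin :=
  Finset.sum_nonneg fun _ _ => by split_ifs <;> norm_num

theorem cutGain_le (α β : ℝ) (s : State n m) (v : Cube m) (coin : Fin n → Bool) :
    cutGain α β s v coin ≤ n := by
  calc cutGain α β s v coin ≤ ∑ _b : Fin n, (1 : ℝ) :=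
        Finset.sum_le_sum fun _ _ => by split_ifs <;> norm_num
    _ = n := by simp

/-- Cut edges at the deleted node disappear and those offered to the new node appear. This is an
inequality, as `cutGain` also counts an offer from the node about to be deleted; in return it does
not depend on `D`, so loss and gain can be averaged separately. -/
theorem cutSum_next_le (α β : ℝ) (s : State n m) (c : Choices n m) :
    cutSum (next α β (s, c)) ≤ cutSum s - cutDegree s c.2.2.1 + cutGain α β s c.1 c.2.1 := by
  classical
  obtain ⟨v, coin, D, R⟩ := c
  -- The state before the ranks are updated; relabelling does not change a sum over all pairs.
  let s' : State n m := (Function.update s.1 D v, relink α β s v coin D)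
  have h1 : cutSum (next α β (s, v, coin, D, R)) = cutSum s' := by
    unfold cutSum
    rw [← Equiv.sum_comp (rankUpdate D R)]
    refine Finset.sum_congr rfl fun a _ => ?_
    rw [← Equiv.sum_comp (rankUpdate D R)]
    refine Finset.sum_congr rfl fun b _ => ?_
    simp only [cutIndicator, next, SimpleGraph.comap_adj, Equiv.symm_apply_apply, s']
  let g : Fin n → ℝ := fun b =>
    if v ∈ torusBall (s.1 b) (influenceVolume α β n (b + 1)) ∧ coin b = true then 1 else 0
  let g₁ : Fin n → ℝ := fun b => if v ∈ halfCube m ∧ s.1 b ∉ halfCube m then g b else 0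
  let g₂ : Fin n → ℝ := fun a => if s.1 a ∈ halfCube m ∧ v ∉ halfCube m then g a else 0
  have hg : ∀ b, 0 ≤ g b := fun b => by simp only [g]; split_ifs <;> norm_num
  have hg₁ : ∀ b, 0 ≤ g₁ b := fun b => by
    simp only [g₁]; split_ifs; exacts [hg b, le_rfl]
  have hg₂ : ∀ b, 0 ≤ g₂ b := fun b => by
    simp only [g₂]; split_ifs; exacts [hg b, le_rfl]
  have h2 : ∀ a b, cutIndicator s' a b ≤ cutIndicator s a b
      - (if a = D then cutIndicator s D b else 0) - (if b = D then cutIndicator s a D else 0)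
      + (if a = D then g₁ b else 0) + (if b = D then g₂ a else 0) := by
    intro a b
    by_cases ha : a = D
    · by_cases hb : b = D
      · have h3 : ∀ s : State n m, cutIndicator s D D = 0 := fun s => by simp [cutIndicator]
        simp only [ha, hb, if_true, h3]
        linarith [hg₁ D, hg₂ D]
      · subst ha
        simp only [hb, if_true, if_false]
        have : cutIndicator s' a b ≤ g₁ b := by
          simp only [cutIndicator, s', relink, g₁, g, Function.update_self,
            Function.update_of_ne hb, if_true]
          split_ifs <;> first | exact le_rfl | exact zero_le_one | (exfalso; tauto)
        linarith
    · by_cases hb : b = D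
      · subst hb
        simp only [ha, if_true, if_false]
        have : cutIndicator s' a b ≤ g₂ a := by
          simp only [cutIndicator, s', relink, g₂, g, Function.update_self,
            Function.update_of_ne ha, if_true, if_neg ha]
          split_ifs <;> first | exact le_rfl | exact zero_le_one | (exfalso; tauto)
        linarith
      · simp only [ha, hb, if_false]
        have : cutIndicator s' a b = cutIndicator s a b := by
          have : a = b → ¬ s.2.Adj a b := fun h => by simp [h]
          simp only [cutIndicator, s', relink, Function.update_of_ne ha, Function.update_of_ne hb,
            if_neg ha, if_neg hb]
          congr 1
          simp only [eq_iff_iff]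
          tauto
        linarith
  have h3 : ∑ b, (g₁ b + g₂ b) ≤ cutGain α β s v coin := by
    refine Finset.sum_le_sum fun b _ => ?_
    simp only [g₁, g₂, g, crossBall, Set.mem_ofPred_eq]
    by_cases h1 : s.1 b ∈ halfCube m <;> by_cases h2 : v ∈ halfCube m <;>
      by_cases h3 : v ∈ torusBall (s.1 b) (influenceVolume α β n (b + 1)) <;>
      by_cases h4 : coin b = true <;> simp [h1, h2, h3, h4]
  rw [h1]
  calc cutSum s' ≤ ∑ a, ∑ b, (cutIndicator s a b
      - (if a = D then cutIndicator s D b else 0) - (if b = D then cutIndicator s a D else 0)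
      + (if a = D then g₁ b else 0) + (if b = D then g₂ a else 0)) :=
        Finset.sum_le_sum fun a _ => Finset.sum_le_sum fun b _ => h2 a b
    _ = cutSum s - cutDegree s D + ∑ b, (g₁ b + g₂ b) := by
        have e : ∀ f : Fin n → ℝ, ∑ a, ∑ b, (if a = D then f b else 0) = ∑ b, f b := fun f => by
          rw [Finset.sum_comm]; simp
        simp only [Finset.sum_add_distrib, Finset.sum_sub_distrib, cutSum, cutDegree, e,
          Finset.sum_ite_eq', Finset.mem_univ, if_true]
        ring
    _ ≤ _ := by simpa using h3

theorem measurableSet_halfCube : MeasurableSet (halfCube m) := by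
  unfold halfCube
  rw [Set.ofPred_forall]
  refine MeasurableSet.iInter fun h => measurableSet_le ?_ measurable_const
  fun_prop

theorem measurable_cutSum : Measurable (cutSum : State n m → ℝ) := by
  classical
  unfold cutSum cutIndicator
  refine Finset.measurable_fun_sum _ fun a _ => Finset.measurable_fun_sum _ fun b _ => ?_
  refine Measurable.ite ?_ measurable_const measurable_const
  have h : ∀ a : Fin n, Measurable fun s : State n m => s.1 a := fun a => by fun_prop
  refine (h a measurableSet_halfCube).inter (((h b measurableSet_halfCube).compl).inter ?_)
  exact measurableSet_setOfPred.2 (SimpleGraph.measurable_iff_adj.1 measurable_snd a b)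

theorem measurableSet_crossBall_prod (V : ℝ) :
    MeasurableSet {q : Cube m × Cube m | q.2 ∈ crossBall q.1 V} := by
  have h1 : MeasurableSet {q : Cube m × Cube m | q.2 ∈ torusBall q.1 V} :=
    measurableSet_le measurable_torusDist measurable_const
  have h2 : MeasurableSet (Prod.fst ⁻¹' halfCube m : Set (Cube m × Cube m)) :=
    measurable_fst measurableSet_halfCube
  have h3 : MeasurableSet (Prod.snd ⁻¹' halfCube m : Set (Cube m × Cube m)) :=
    measurable_snd measurableSet_halfCube
  have : {q : Cube m × Cube m | q.2 ∈ crossBall q.1 V} = {q | q.2 ∈ torusBall q.1 V} ∩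
      ((Prod.fst ⁻¹' halfCube m \ Prod.snd ⁻¹' halfCube m) ∪
        (Prod.snd ⁻¹' halfCube m \ Prod.fst ⁻¹' halfCube m)) := by
    ext q
    simp only [crossBall, Set.mem_ofPred_eq, Set.mem_inter_iff, Set.mem_union, Set.mem_sdiff,
      Set.mem_preimage]
    tauto
  rw [this]
  exact h1.inter ((h2.diff h3).union (h3.diff h2))

theorem measurableSet_crossBall (x : Cube m) (V : ℝ) : MeasurableSet (crossBall x V) :=
  measurable_prodMk_left (measurableSet_crossBall_prod V)

/-- The mean number of cut edges offered to the new node. -/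
noncomputable def meanGain (α β : ℝ) (p : unitInterval) (s : State n m) : ℝ :=
  p * ∑ b : Fin n, volume.real (crossBall (s.1 b) (influenceVolume α β n (b + 1)))

theorem meanGain_nonneg (α β : ℝ) (p : unitInterval) (s : State n m) : 0 ≤ meanGain α β p s :=
  mul_nonneg p.2.1 (Finset.sum_nonneg fun _ _ => measureReal_nonneg)

theorem meanGain_le (α β : ℝ) (p : unitInterval) (s : State n m) : meanGain α β p s ≤ n := by
  have h1 : ∑ b : Fin n, volume.real (crossBall (s.1 b) (influenceVolume α β n (b + 1))) ≤
      ∑ _b : Fin n, (1 : ℝ) := Finset.sum_le_sum fun _ _ => measureReal_le_one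
  have h2 : (0 : ℝ) ≤ ∑ b : Fin n, volume.real
      (crossBall (s.1 b) (influenceVolume α β n (b + 1))) :=
    Finset.sum_nonneg fun _ _ => measureReal_nonneg
  simp only [Finset.sum_const, Finset.card_univ, Fintype.card_fin, nsmul_eq_mul, mul_one] at h1
  exact (mul_le_of_le_one_left h2 p.2.2).trans h1

theorem measurable_meanGain (α β : ℝ) (p : unitInterval) :
    Measurable (meanGain α β p : State n m → ℝ) := by
  refine measurable_const.mul (Finset.measurable_fun_sum _ fun b _ => ?_)
  have := measurable_measure_prodMk_left (ν := (volume : Measure (Cube m)))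
    (measurableSet_crossBall_prod (m := m) (influenceVolume α β n (b + 1)))
  exact this.ennreal_toReal.comp (by fun_prop : Measurable fun s : State n m => s.1 b)

variable [NeZero n] {ρ : Measure (Fin n)} [IsProbabilityMeasure ρ]

theorem measurable_cutGain (α β : ℝ) (s : State n m) :
    Measurable fun c : Choices n m => cutGain α β s c.1 c.2.1 := by
  classical
  refine Finset.measurable_fun_sum _ fun b _ => ?_
  refine Measurable.ite ?_ measurable_const measurable_const
  have h2 : Measurable fun c : Choices n m => c.2.1 b := by fun_prop
  exact (measurable_fst (measurableSet_crossBall _ _)).inter (h2 (measurableSet_singleton true))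

theorem integral_cutGain (α β : ℝ) (p : unitInterval) (s : State n m) :
    ∫ c, cutGain α β s c.1 c.2.1 ∂(choiceLaw m p ρ) = meanGain α β p s := by
  classical
  have : IsProbabilityMeasure (uniformOn (Set.univ : Set (Fin n))) :=
    isProbabilityMeasure_uniformOn Set.finite_univ Set.univ_nonempty
  have hset : ∀ b : Fin n, MeasurableSet ((crossBall (s.1 b) (influenceVolume α β n (b + 1))) ×ˢ
      ((Function.eval b ⁻¹' {true} : Set (Fin n → Bool)) ×ˢ
        (Set.univ : Set (Fin n × Fin n)))) := fun b =>
    (measurableSet_crossBall _ _).prod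
      ((measurable_pi_apply b (measurableSet_singleton true)).prod .univ)
  have h1 : ∀ c : Choices n m, cutGain α β s c.1 c.2.1 = ∑ b : Fin n,
      ((crossBall (s.1 b) (influenceVolume α β n (b + 1))) ×ˢ
      ((Function.eval b ⁻¹' {true} : Set (Fin n → Bool)) ×ˢ
        (Set.univ : Set (Fin n × Fin n)))).indicator (1 : Choices n m → ℝ) c := fun c => by
    refine Finset.sum_congr rfl fun b _ => ?_
    simp [Set.indicator_apply]
  simp_rw [h1]
  have hone : Integrable (1 : Choices n m → ℝ) (choiceLaw m p ρ) := integrable_const 1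
  rw [integral_finsetSum _ fun b _ => hone.indicator (hset b), meanGain,
    Finset.mul_sum]
  refine Finset.sum_congr rfl fun b _ => ?_
  rw [integral_indicator_one (hset b)]
  have h2 : (Measure.pi fun _ : Fin n => bernoulliMeasure true false p).real
      (Function.eval b ⁻¹' {true}) = p := by
    rw [measureReal_def, (measurePreserving_eval (fun _ : Fin n => bernoulliMeasure true false p)
      b).measure_preimage (measurableSet_singleton true).nullMeasurableSet, ← measureReal_def,
      bernoulliMeasure_real_apply_of_mem_of_notMem] <;> simp
  rw [choiceLaw, measureReal_prod_prod, measureReal_prod_prod, h2, probReal_univ]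
  ring

end Cut

/-! ### Exponential moments and the tail of the cut -/

section Drift

variable {n m : ℕ} [NeZero n] {α β : ℝ} {p : unitInterval} {ρ : Measure (Fin n)}
  [IsProbabilityMeasure ρ]

/-- For `|y| ≤ κ ≤ 1` one has `exp y ≤ 1 + y + y²`, and with `y = lam (G - L)` the square is at most
`κ lam (G + L)`. The bound is linear in `G` and `L`, so that only their means matter afterwards. -/
theorem exp_mul_sub_le {lam κ N L G : ℝ} (hlam : 0 ≤ lam) (hκ : κ = lam * N) (hκ1 : κ ≤ 1)
    (hL : 0 ≤ L) (hLN : L ≤ N) (hG : 0 ≤ G) (hGN : G ≤ N) :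
    Real.exp (lam * (G - L)) ≤ 1 + lam * ((1 + κ) * G - (1 - κ) * L) := by
  have h1 : |lam * (G - L)| ≤ κ := by
    rw [abs_mul, abs_of_nonneg hlam, hκ]
    exact mul_le_mul_of_nonneg_left (abs_le.2 ⟨by linarith, by linarith⟩) hlam
  have h2 := (abs_le.1 (Real.abs_exp_sub_one_sub_id_le (h1.trans hκ1))).2
  have h3 : (lam * (G - L)) ^ 2 ≤ κ * (lam * (G + L)) := by
    rw [← sq_abs, sq]
    refine mul_le_mul h1 ?_ (abs_nonneg _) ((abs_nonneg _).trans h1)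
    rw [abs_mul, abs_of_nonneg hlam]
    exact mul_le_mul_of_nonneg_left (abs_le.2 ⟨by linarith, by linarith⟩) hlam
  linarith

theorem meanAfter_exp_cutSum_le {lam κ : ℝ} (hlam : 0 ≤ lam) (hκ : κ = lam * n) (hκ1 : κ ≤ 1)
    (s : State n m) :
    meanAfter α β p ρ (fun s => Real.exp (lam * cutSum s)) s ≤ Real.exp (lam * cutSum s) *
      (1 + lam * ((1 + κ) * meanGain α β p s - (1 - κ) * (2 * cutSum s / n))) := by
  have hG : Integrable (fun c : Choices n m => cutGain α β s c.1 c.2.1) (choiceLaw m p ρ) :=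
    integrable_of_mem_Icc (measurable_cutGain α β s) fun c =>
      ⟨cutGain_nonneg α β s c.1 c.2.1, cutGain_le α β s c.1 c.2.1⟩
  have hL : Integrable (fun c : Choices n m => cutDegree s c.2.2.1) (choiceLaw m p ρ) :=
    integrable_of_mem_Icc ((measurable_of_finite (cutDegree s)).comp
      (f := fun c : Choices n m => c.2.2.1) (by fun_prop)) fun c =>
      ⟨cutDegree_nonneg s c.2.2.1, cutDegree_le s c.2.2.1⟩
  have hi : Integrable (fun c : Choices n m => 1 + lam * ((1 + κ) * cutGain α β s c.1 c.2.1 -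
      (1 - κ) * cutDegree s c.2.2.1)) (choiceLaw m p ρ) :=
    (integrable_const 1).add (((hG.const_mul _).sub (hL.const_mul _)).const_mul _)
  calc meanAfter α β p ρ (fun s => Real.exp (lam * cutSum s)) s
      ≤ ∫ c : Choices n m, Real.exp (lam * cutSum s) * (1 + lam * ((1 + κ) *
        cutGain α β s c.1 c.2.1 - (1 - κ) * cutDegree s c.2.2.1)) ∂(choiceLaw m p ρ) := by
        refine integral_mono ?_ (hi.const_mul _) fun c => ?_
        · refine integrable_of_mem_Icc (a := 0) (b := Real.exp (lam * (n : ℝ) ^ 2)) ?_ fun c => ?_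
          · exact Real.measurable_exp.comp (measurable_const.mul
              (measurable_cutSum.comp (measurable_next_right s)))
          · exact ⟨(Real.exp_pos _).le, Real.exp_le_exp.2
              (mul_le_mul_of_nonneg_left (cutSum_le _) hlam)⟩
        · refine le_trans ?_ (mul_le_mul_of_nonneg_left (exp_mul_sub_le hlam hκ hκ1
            (cutDegree_nonneg s c.2.2.1) (cutDegree_le s c.2.2.1) (cutGain_nonneg α β s c.1 c.2.1)
            (cutGain_le α β s c.1 c.2.1)) (Real.exp_pos _).le)
          rw [← Real.exp_add]
          refine Real.exp_le_exp.2 ?_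
          rw [← mul_add]
          exact mul_le_mul_of_nonneg_left (by linarith [cutSum_next_le α β s c]) hlam
    _ = _ := by
        have h1 : Integrable (fun c : Choices n m => (1 + κ) * cutGain α β s c.1 c.2.1 -
          (1 - κ) * cutDegree s c.2.2.1) (choiceLaw m p ρ) :=
          (hG.const_mul _).sub (hL.const_mul _)
        rw [integral_const_mul, integral_add (integrable_const 1) (h1.const_mul _),
          integral_const_mul,
          integral_sub (hG.const_mul _) (hL.const_mul _), integral_const_mul, integral_const_mul,
          integral_cutGain, integral_choiceLaw_deleted m p ρ (cutDegree s), sum_cutDegree]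
        simp

theorem integrable_drift (π : Measure (State n m)) [IsProbabilityMeasure π] {lam : ℝ}
    (hlam : 0 < lam) (κ : ℝ) : Integrable (fun s : State n m => Real.exp (lam * cutSum s) *
      ((1 - κ) * (2 * cutSum s / n) - (1 + κ) * meanGain α β p s)) π := by
  have hX : Integrable (fun s : State n m => (1 - κ) * (2 * cutSum s / n) -
      (1 + κ) * meanGain α β p s) π :=
    (((integrable_of_mem_Icc measurable_cutSum fun s =>
      ⟨cutSum_nonneg s, cutSum_le s⟩).const_mul 2 |>.div_const _).const_mul _).sub
      ((integrable_of_mem_Icc (measurable_meanGain α β p) fun s =>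
        ⟨meanGain_nonneg α β p s, meanGain_le α β p s⟩).const_mul _)
  refine hX.bdd_mul (c := Real.exp (lam * (n : ℝ) ^ 2)) (Real.measurable_exp.comp
    (measurable_const.mul measurable_cutSum)).aestronglyMeasurable (.of_forall fun s => ?_)
  rw [Real.norm_of_nonneg (Real.exp_pos _).le]
  exact Real.exp_le_exp.2 (mul_le_mul_of_nonneg_left (cutSum_le _) hlam.le)

/-- Stationarity of the exponential moments of the cut. -/
theorem IsGeoP.integral_drift_le {π : Measure (State n m)} (h : IsGeoP α β p ρ π) {lam κ : ℝ}
    (hlam : 0 < lam) (hκ : κ = lam * n) (hκ1 : κ ≤ 1) :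
    ∫ s, Real.exp (lam * cutSum s) *
      ((1 - κ) * (2 * cutSum s / n) - (1 + κ) * meanGain α β p s) ∂π ≤ 0 := by
  have := h.1
  have hE : Measurable fun s : State n m => Real.exp (lam * cutSum s) :=
    Real.measurable_exp.comp (measurable_const.mul measurable_cutSum)
  have hE01 : ∀ s : State n m,
      Real.exp (lam * cutSum s) ∈ Set.Icc 0 (Real.exp (lam * (n : ℝ) ^ 2)) := fun s =>
    ⟨(Real.exp_pos _).le, Real.exp_le_exp.2 (mul_le_mul_of_nonneg_left (cutSum_le _) hlam.le)⟩
  have hEi : Integrable (fun s : State n m => Real.exp (lam * cutSum s)) π :=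
    integrable_of_mem_Icc hE hE01
  have hi := integrable_drift (α := α) (β := β) (p := p) π hlam κ
  have h1 := integral_bind_transition (α := α) (β := β) (p := p) (ρ := ρ) hE hE01 π
  have h2 : π.bind (transition m α β p ρ) = π := h.2
  rw [h2] at h1
  have h3 := integral_mono (μ := π) (integrable_of_mem_Icc (measurable_meanAfter hE)
    (meanAfter_mem_Icc (α := α) (β := β) (p := p) (ρ := ρ) hE hE01)) (hEi.sub (hi.const_mul lam))
    fun s => (meanAfter_exp_cutSum_le hlam.le hκ hκ1 s).trans (le_of_eq (by
      simp only [Pi.sub_apply]; ring))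
  simp only [Pi.sub_apply] at h3
  rw [← h1, integral_sub hEi (hi.const_mul lam), integral_const_mul] at h3
  nlinarith

/-- A tail bound for the cut in terms of a tail bound for the mean gain. -/
theorem IsGeoP.measureReal_cutSum_ge_le {π : Measure (State n m)} (h : IsGeoP α β p ρ π)
    {lam κ g x η b : ℝ} (hlam : 0 < lam) (hκ : κ = lam * n) (hκ1 : κ ≤ 1 / 2) (hg : 0 ≤ g)
    (hx : (1 + κ) * g * n = 2 * (1 - κ) * x) (hη : 0 < η)
    (hb : π.real {s | g < meanGain α β p s} ≤ b) :
    π.real {s | x + η ≤ cutSum s} ≤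
      x / η * Real.exp (-(lam * η)) + 2 * (n : ℝ) ^ 2 / η * Real.exp (lam * (n : ℝ) ^ 2) * b + b := by
  have := h.1
  have hn : (0 : ℝ) < n := Nat.cast_pos.2 (NeZero.pos n)
  have hκ0 : 0 < κ := by rw [hκ]; positivity
  have hx0 : 0 ≤ x := by
    have : 0 ≤ (1 + κ) * g * n := by positivity
    rw [hx] at this
    by_contra hc
    push Not at hc
    nlinarith
  set bad : Set (State n m) := {s | g < meanGain α β p s} with hbad
  set hi : Set (State n m) := {s | x + η ≤ cutSum s} with hhi
  have hbadm : MeasurableSet bad := measurableSet_lt measurable_const (measurable_meanGain α β p)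
  have hhim : MeasurableSet hi := measurableSet_le measurable_const measurable_cutSum
  have hd := h.integral_drift_le hlam hκ (by linarith)
  set M := Real.exp (lam * (n : ℝ) ^ 2) with hM
  -- By `hx` the level `x` is where loss balances a gain `g`: off `bad` the drift is at least `c
  -- (cutSum s - x)`.
  set c := 2 * (1 - κ) / n with hc
  have hc0 : 0 < c := div_pos (by linarith) hn
  have hcx : (1 + κ) * g = c * x := by rw [hc]; field_simp; linarith
  -- A pointwise minorant of the integrand, whose integral is at most `0`. On `bad` it uses the
  -- crude bounds `meanGain ≤ n` and `cutSum ≤ n²`. Elsewhere the integrand is large above `x + η`,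
  -- nonnegative from `x` on, and at least `-c x exp (lam x)` below `x`.
  have hlow : ∀ s : State n m, c * Real.exp (lam * (x + η)) * η * (hi \ bad).indicator 1 s
      - c * x * Real.exp (lam * x) - 2 * n * M * bad.indicator 1 s ≤
      Real.exp (lam * cutSum s) *
      ((1 - κ) * (2 * cutSum s / n) - (1 + κ) * meanGain α β p s) := by
    intro s
    have e1 : (1 - κ) * (2 * cutSum s / n) = c * cutSum s := by rw [hc]; ring
    have hE : 0 < Real.exp (lam * cutSum s) := Real.exp_pos _
    have hY := cutSum_nonneg s
    have hcxE : 0 ≤ c * x * Real.exp (lam * x) := by positivity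
    rw [e1]
    by_cases hs : s ∈ bad
    · have hEM : Real.exp (lam * cutSum s) ≤ M :=
        Real.exp_le_exp.2 (mul_le_mul_of_nonneg_left (cutSum_le _) hlam.le)
      have h1 : Real.exp (lam * cutSum s) * ((1 + κ) * meanGain α β p s) ≤ M * (2 * n) := by
        refine mul_le_mul hEM ?_ (mul_nonneg (by linarith) (meanGain_nonneg α β p s))
          (Real.exp_pos _).le
        exact mul_le_mul (by linarith) (meanGain_le α β p s) (meanGain_nonneg α β p s) (by norm_num)
      have h2 : 0 ≤ Real.exp (lam * cutSum s) * (c * cutSum s) := by positivity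
      simp only [Set.indicator_of_mem hs, Set.indicator_of_notMem (show s ∉ hi \ bad from
        fun h => h.2 hs), Pi.one_apply]
      linarith
    · have hgs : meanGain α β p s ≤ g := not_lt.1 hs
      have h1 : Real.exp (lam * cutSum s) * (c * (cutSum s - x)) ≤
          Real.exp (lam * cutSum s) * (c * cutSum s - (1 + κ) * meanGain α β p s) := by
        refine mul_le_mul_of_nonneg_left ?_ hE.le
        have : (1 + κ) * meanGain α β p s ≤ (1 + κ) * g :=
          mul_le_mul_of_nonneg_left hgs (by linarith)
        linarith
      refine le_trans ?_ h1
      rw [Set.indicator_of_notMem hs]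
      by_cases hs2 : s ∈ hi
      · have hs3 : x + η ≤ cutSum s := hs2
        rw [Set.indicator_of_mem (show s ∈ hi \ bad from ⟨hs2, hs⟩), Pi.one_apply]
        have h2 : Real.exp (lam * (x + η)) * (c * η) ≤
            Real.exp (lam * cutSum s) * (c * (cutSum s - x)) := by
          refine mul_le_mul (Real.exp_le_exp.2 (mul_le_mul_of_nonneg_left hs3 hlam.le)) ?_
            (by positivity) hE.le
          exact mul_le_mul_of_nonneg_left (by linarith) hc0.le
        linarith
      · rw [Set.indicator_of_notMem (show s ∉ hi \ bad from fun h => hs2 h.1)]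
        rcases le_total x (cutSum s) with hxs | hxs
        · have : 0 ≤ Real.exp (lam * cutSum s) * (c * (cutSum s - x)) :=
            mul_nonneg hE.le (mul_nonneg hc0.le (by linarith))
          linarith
        · have : Real.exp (lam * cutSum s) * (c * (x - cutSum s)) ≤
              Real.exp (lam * x) * (c * x) := by
            refine mul_le_mul (Real.exp_le_exp.2 (mul_le_mul_of_nonneg_left hxs hlam.le)) ?_
              (mul_nonneg hc0.le (by linarith)) (Real.exp_pos _).le
            exact mul_le_mul_of_nonneg_left (by linarith) hc0.le
          linarith
  have hone : Integrable (1 : State n m → ℝ) π := integrable_const 1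
  have hI1 := hone.indicator (hhim.diff hbadm)
  have hI2 := hone.indicator hbadm
  have hmain := (integral_mono (μ := π) (((hI1.const_mul (c * Real.exp (lam * (x + η)) * η)).sub
    (integrable_const (c * x * Real.exp (lam * x)))).sub (hI2.const_mul (2 * n * M)))
    (integrable_drift π hlam κ) hlow).trans hd
  simp only [Pi.sub_apply] at hmain
  have hI3 : Integrable (fun s : State n m =>
      c * Real.exp (lam * (x + η)) * η * (hi \ bad).indicator 1 s -
      c * x * Real.exp (lam * x)) π := (hI1.const_mul _).sub (integrable_const _)
  rw [integral_sub hI3 (hI2.const_mul _), integral_sub (hI1.const_mul _) (integrable_const _),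
    integral_const_mul, integral_const_mul, integral_const_mul,
    integral_indicator_one (hhim.diff hbadm), integral_indicator_one hbadm, integral_const, probReal_univ, one_smul] at hmain
  have hE0 := Real.exp_pos (lam * (x + η))
  have hE1 : 1 ≤ Real.exp (lam * (x + η)) := Real.one_le_exp (by positivity)
  have hM0 : 0 < M := Real.exp_pos _
  have hc1 : 1 / n ≤ c := by
    rw [hc]; exact div_le_div_of_nonneg_right (by linarith) hn.le
  have hb0 : 0 ≤ b := measureReal_nonneg.trans hb
  have h1 : π.real (hi \ bad) ≤
      (c * x * Real.exp (lam * x) + 2 * n * M * b) / (c * Real.exp (lam * (x + η)) * η) := by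
    rw [le_div_iff₀ (by positivity)]
    have : 2 * n * M * π.real bad ≤ 2 * n * M * b := mul_le_mul_of_nonneg_left hb (by positivity)
    linarith
  have h2 : (c * x * Real.exp (lam * x) + 2 * n * M * b) / (c * Real.exp (lam * (x + η)) * η) ≤
      x / η * Real.exp (-(lam * η)) + 2 * (n : ℝ) ^ 2 / η * M * b := by
    rw [add_div]
    refine add_le_add (le_of_eq ?_) ?_
    · rw [show lam * x = lam * (x + η) + -(lam * η) by ring, Real.exp_add]
      field_simp
    · rw [div_le_iff₀ (by positivity)]
      have h3 : 1 ≤ n * c * Real.exp (lam * (x + η)) := by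
        have : 1 ≤ n * c := by rwa [div_le_iff₀' hn] at hc1
        nlinarith
      calc 2 * n * M * b ≤ 2 * n * M * b * (n * c * Real.exp (lam * (x + η))) :=
            le_mul_of_one_le_right (by positivity) h3
        _ = _ := by field_simp
  have h3 : π.real hi ≤ π.real (hi \ bad) + π.real bad := by
    refine (measureReal_mono (fun s hs => ?_)).trans (measureReal_union_le _ _)
    by_cases h : s ∈ bad
    · exact Or.inr h
    · exact Or.inl ⟨hs, h⟩
  linarith

end Drift

/-! ### Volume of a ball in the other half of the torus -/

section Geometry

/-- An upper bound for the length of the part of the interval of radius `r` around `a` on the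
circle that lies in the other half of the circle. -/
noncomputable def crossProfile (r a : ℝ) : ℝ :=
  max (r - |a - 1 / 2|) 0 + max (r - a) 0 + max (r - (1 - a)) 0

theorem crossProfile_nonneg (r a : ℝ) : 0 ≤ crossProfile r a := by
  unfold crossProfile; positivity

/-- Each summand is at most `r`, and a point cannot be within `r ≤ 1/2` of both ends `0` and `1`
with positive excess. -/
theorem crossProfile_le {r a : ℝ} (hr : 0 ≤ r) (hr2 : r ≤ 1 / 2) (ha : a ∈ Set.Icc (0 : ℝ) 1) :
    crossProfile r a ≤ 2 * r := by
  have h1 : max (r - |a - 1 / 2|) 0 ≤ r := max_le (by linarith [abs_nonneg (a - 1 / 2)]) hr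
  have h2 : max (r - a) 0 ≤ r := max_le (by linarith [ha.1]) hr
  have h3 : max (r - (1 - a)) 0 ≤ r := max_le (by linarith [ha.2]) hr
  unfold crossProfile
  rcases le_total a (1 / 2) with h | h
  · rw [max_eq_right (show r - (1 - a) ≤ 0 by linarith)]; linarith
  · rw [max_eq_right (show r - a ≤ 0 by linarith)]; linarith

theorem continuous_crossProfile (r : ℝ) : Continuous (crossProfile r) := by
  unfold crossProfile; fun_prop

theorem integral_max_sub {r l : ℝ} (hr : 0 ≤ r) (hl : r ≤ l) :
    ∫ a in (0 : ℝ)..l, max (r - a) 0 = r ^ 2 / 2 := by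
  have hc : Continuous fun a : ℝ => max (r - a) 0 := by fun_prop
  rw [← intervalIntegral.integral_add_adjacent_intervals (hc.intervalIntegrable 0 r)
    (hc.intervalIntegrable r l)]
  have h1 : ∫ a in (0 : ℝ)..r, max (r - a) 0 = ∫ a in (0 : ℝ)..r, (r - a) := by
    refine intervalIntegral.integral_congr fun a ha => ?_
    rw [Set.uIcc_of_le hr] at ha
    exact max_eq_left (by linarith [ha.2])
  have h2 : ∫ a in r..l, max (r - a) 0 = ∫ a in r..l, (0 : ℝ) := by
    refine intervalIntegral.integral_congr fun a ha => ?_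
    rw [Set.uIcc_of_le hl] at ha
    exact max_eq_right (by linarith [ha.1])
  rw [h1, h2, intervalIntegral.integral_sub (by simp) (by simp)]
  simp
  ring

/-- The two halves of the circle meet at `1/2` and at `0 = 1`; each meeting point contributes `r ^
2`, the latter as two triangles at the ends of `[0,1]`. -/
theorem integral_crossProfile {r : ℝ} (hr : 0 ≤ r) (hr2 : r ≤ 1 / 2) :
    ∫ a in (0 : ℝ)..1, crossProfile r a = 2 * r ^ 2 := by
  have hc1 : Continuous fun a : ℝ => max (r - |a - 1 / 2|) 0 := by fun_prop
  have hc2 : Continuous fun a : ℝ => max (r - a) 0 := by fun_prop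
  have hc3 : Continuous fun a : ℝ => max (r - (1 - a)) 0 := by fun_prop
  have h3 : ∫ a in (0 : ℝ)..1, max (r - (1 - a)) 0 = r ^ 2 / 2 := by
    rw [intervalIntegral.integral_comp_sub_left (fun a => max (r - a) 0) 1]
    simpa using integral_max_sub hr (show r ≤ 1 by linarith)
  have h1 : ∫ a in (0 : ℝ)..1, max (r - |a - 1 / 2|) 0 = r ^ 2 := by
    rw [← intervalIntegral.integral_add_adjacent_intervals (hc1.intervalIntegrable 0 (1 / 2))
      (hc1.intervalIntegrable (1 / 2) 1)]
    have e1 : ∫ a in (0 : ℝ)..(1 / 2), max (r - |a - 1 / 2|) 0 = r ^ 2 / 2 := by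
      have : ∫ a in (0 : ℝ)..(1 / 2), max (r - |a - 1 / 2|) 0 =
          ∫ a in (0 : ℝ)..(1 / 2), max (r - (1 / 2 - a)) 0 := by
        refine intervalIntegral.integral_congr fun a ha => ?_
        rw [Set.uIcc_of_le (by norm_num)] at ha
        rw [abs_of_nonpos (by linarith [ha.2]), neg_sub]
      rw [this, intervalIntegral.integral_comp_sub_left (fun a => max (r - a) 0) (1 / 2)]
      simpa using integral_max_sub hr hr2
    have e2 : ∫ a in (1 / 2 : ℝ)..1, max (r - |a - 1 / 2|) 0 = r ^ 2 / 2 := by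
      have : ∫ a in (1 / 2 : ℝ)..1, max (r - |a - 1 / 2|) 0 =
          ∫ a in (1 / 2 : ℝ)..1, max (r - (a - 1 / 2)) 0 := by
        refine intervalIntegral.integral_congr fun a ha => ?_
        rw [Set.uIcc_of_le (by norm_num)] at ha
        rw [abs_of_nonneg (by linarith [ha.1])]
      rw [this, intervalIntegral.integral_comp_sub_right (fun a => max (r - a) 0) (1 / 2)]
      norm_num
      simpa using integral_max_sub hr hr2
    rw [e1, e2]; ring
  have h12 : IntervalIntegrable (fun a : ℝ => max (r - |a - 1 / 2|) 0 + max (r - a) 0) volume 0 1 :=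
    (hc1.add hc2).intervalIntegrable 0 1
  simp only [crossProfile]
  rw [intervalIntegral.integral_add h12
    (hc3.intervalIntegrable 0 1), intervalIntegral.integral_add (hc1.intervalIntegrable 0 1)
    (hc2.intervalIntegrable 0 1), h1, h3, integral_max_sub hr (show r ≤ 1 by linarith)]
  ring

theorem volume_coe_preimage_le (T : Set ℝ) :
    volume ((↑) ⁻¹' T : Set unitInterval) ≤ volume (T ∩ Set.Icc 0 1) := by
  rw [← Subtype.range_coe (s := Set.Icc (0 : ℝ) 1), ← Set.image_preimage_eq_inter_range]
  exact (volume_image_subtype_coe measurableSet_Icc _).ge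

/-- The interval of radius `r` around `a` on the circle of length one has length at most `2r`. -/
theorem volume_circle_interval_le (a : unitInterval) (r : ℝ) :
    volume {y : unitInterval | ∃ e : SignType, |(a : ℝ) - y + ((e : ℤ) : ℝ)| ≤ r} ≤
      ENNReal.ofReal (2 * r) := by
  let T : Set ℝ := QuotientAddGroup.mk ⁻¹'
    (Metric.closedBall ((a : ℝ) : UnitAddCircle) r)
  have hT : {y : unitInterval | ∃ e : SignType, |(a : ℝ) - y + ((e : ℤ) : ℝ)| ≤ r} ⊆
      ((↑) ⁻¹' T : Set unitInterval) := by
    rintro y ⟨e, he⟩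
    change dist (((y : ℝ) : ℝ) : UnitAddCircle) ((a : ℝ) : UnitAddCircle) ≤ r
    rw [dist_comm, dist_eq_norm, ← AddCircle.coe_sub, UnitAddCircle.norm_eq]
    have h := round_le ((a : ℝ) - y) (-(e : ℤ))
    rw [Int.cast_neg, sub_neg_eq_add] at h
    exact h.trans he
  have hTm : MeasurableSet T := AddCircle.measurable_mk' Metric.isClosed_closedBall.measurableSet
  calc _ ≤ volume (T ∩ Set.Icc 0 1) := (measure_mono hT).trans (volume_coe_preimage_le T)
    _ = volume.restrict (Set.Icc 0 1) T := (Measure.restrict_apply hTm).symm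
    _ = volume.restrict (Set.Ioc 0 (0 + 1)) T := by
        rw [zero_add, Measure.restrict_congr_set Ioc_ae_eq_Icc]
    _ = volume (Metric.closedBall ((a : ℝ) : UnitAddCircle) r) :=
        (UnitAddCircle.measurePreserving_mk 0).measure_preimage
          Metric.isClosed_closedBall.measurableSet.nullMeasurableSet
    _ ≤ ENNReal.ofReal (2 * r) := by
        rw [AddCircle.volume_closedBall]
        exact ENNReal.ofReal_le_ofReal (min_le_right _ _)

/-- The interval can reach the other half across `1/2` or across `0 = 1`, which leaves two intervals
whose lengths are summands of the profile. -/
theorem volume_circle_cross_le (a : unitInterval) {r : ℝ} (hr2 : r ≤ 1 / 2) :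
    volume {y : unitInterval | (∃ e : SignType, |(a : ℝ) - y + ((e : ℤ) : ℝ)| ≤ r) ∧
      ¬((a : ℝ) ≤ 1 / 2 ↔ (y : ℝ) ≤ 1 / 2)} ≤ ENNReal.ofReal (crossProfile r a) := by
  have hI : ∀ x y : ℝ, volume (Set.Icc x y) = ENNReal.ofReal (max (y - x) 0) := fun x y => by
    rw [Real.volume_Icc]
    rcases le_total 0 (y - x) with h | h
    · rw [max_eq_left h]
    · rw [max_eq_right h, ENNReal.ofReal_of_nonpos h, ENNReal.ofReal_zero]
  have key : ∀ x y x' y' : ℝ, {y : unitInterval | (∃ e : SignType,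
      |(a : ℝ) - y + ((e : ℤ) : ℝ)| ≤ r) ∧ ¬((a : ℝ) ≤ 1 / 2 ↔ (y : ℝ) ≤ 1 / 2)} ⊆
      ((↑) ⁻¹' (Set.Icc x y ∪ Set.Icc x' y') : Set unitInterval) →
      max (y - x) 0 + max (y' - x') 0 ≤ crossProfile r a →
      volume {y : unitInterval | (∃ e : SignType, |(a : ℝ) - y + ((e : ℤ) : ℝ)| ≤ r) ∧
      ¬((a : ℝ) ≤ 1 / 2 ↔ (y : ℝ) ≤ 1 / 2)} ≤ ENNReal.ofReal (crossProfile r a) := by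
    intro x y x' y' h1 h2
    refine (measure_mono h1).trans ((volume_coe_preimage_le _).trans
      ((measure_mono Set.inter_subset_left).trans ((measure_union_le _ _).trans ?_)))
    rw [hI, hI, ← ENNReal.ofReal_add (le_max_right _ _) (le_max_right _ _)]
    exact ENNReal.ofReal_le_ofReal h2
  have ha := a.2
  rcases le_or_gt (a : ℝ) (1 / 2) with h | h
  · refine key (1 / 2) (a + r) (1 - (r - a)) 1 ?_ ?_
    · rintro y ⟨⟨e, he⟩, hy⟩
      have hy1 : 1 / 2 < (y : ℝ) := by
        by_contra hc; exact hy (iff_of_true h (not_lt.1 hc))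
      have hy2 := y.2
      rw [abs_le] at he
      -- The shift `0` means crossing `1/2` and `1` means crossing `0`; the shift `-1` is excluded
      -- by `r ≤ 1/2`.
      rcases e with _ | _ | _
      · left
        simp at he
        exact ⟨hy1.le, by linarith⟩
      · simp at he
        linarith [ha.1, ha.2, hy2.1, hy2.2]
      · right
        simp at he
        exact ⟨by linarith, hy2.2⟩
    · unfold crossProfile
      rw [abs_of_nonpos (by linarith)]
      have := le_max_right (r - (1 - a)) (0 : ℝ)
      rw [show (a : ℝ) + r - 1 / 2 = r - -((a : ℝ) - 1 / 2) by ring,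
        show (1 : ℝ) - (1 - (r - a)) = r - a by ring]
      linarith
  · refine key (a - r) (1 / 2) 0 (r - (1 - a)) ?_ ?_
    · rintro y ⟨⟨e, he⟩, hy⟩
      have hy1 : (y : ℝ) ≤ 1 / 2 := by
        by_contra hc; exact hy (iff_of_false (not_le.2 h) hc)
      have hy2 := y.2
      rw [abs_le] at he
      rcases e with _ | _ | _
      · left
        simp at he
        exact ⟨by linarith, hy1⟩
      · right
        simp at he
        exact ⟨hy2.1, by linarith⟩
      · simp at he
        linarith [ha.1, ha.2, hy2.1, hy2.2]
    · unfold crossProfile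
      rw [abs_of_pos (by linarith)]
      have := le_max_right (r - a) (0 : ℝ)
      rw [show (1 : ℝ) / 2 - (a - r) = r - ((a : ℝ) - 1 / 2) by ring,
        show r - (1 - (a : ℝ)) - 0 = r - (1 - a) by ring]
      linarith

theorem exists_abs_le_of_mem_torusBall {m : ℕ} {x y : Cube m} {V : ℝ} (h : y ∈ torusBall x V)
    (i : Fin m) :
    ∃ e : SignType, |(x i : ℝ) - y i + ((e : ℤ) : ℝ)| ≤ V ^ (1 / (m : ℝ)) / 2 := by
  obtain ⟨u, hu⟩ := exists_eq_ciInf_of_finite (f := fun u : Fin m → SignType =>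
    ‖fun i => (x i : ℝ) - (y i : ℝ) + ((u i : ℤ) : ℝ)‖)
  have h1 : ‖fun i => (x i : ℝ) - (y i : ℝ) + ((u i : ℤ) : ℝ)‖ ≤ V ^ (1 / (m : ℝ)) / 2 := by
    rw [hu]; exact h
  exact ⟨u i, (norm_le_pi_norm (fun i => (x i : ℝ) - (y i : ℝ) + ((u i : ℤ) : ℝ)) i).trans h1⟩

/-- The set lies in a box. Only the first coordinate decides the half, so its side is bounded by the
profile and the other `m - 1` sides by `V ^ (1 / m)`. -/
theorem volume_crossBall_le {m : ℕ} (hm : 0 < m) (x : Cube m) {V : ℝ} (hV : 0 ≤ V) (hV1 : V ≤ 1) :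
    volume.real (crossBall x V) ≤
      (V ^ (1 / (m : ℝ))) ^ (m - 1) * crossProfile (V ^ (1 / (m : ℝ)) / 2) (x ⟨0, hm⟩) := by
  set r := V ^ (1 / (m : ℝ)) / 2 with hr
  have hV0 : 0 ≤ V ^ (1 / (m : ℝ)) := Real.rpow_nonneg hV _
  have hr2 : r ≤ 1 / 2 := by
    have : V ^ (1 / (m : ℝ)) ≤ 1 := Real.rpow_le_one hV hV1 (by positivity)
    linarith
  let i₀ : Fin m := ⟨0, hm⟩
  let T : Fin m → Set unitInterval := fun i =>
    {y | (∃ e : SignType, |(x i : ℝ) - y + ((e : ℤ) : ℝ)| ≤ r) ∧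
      (i = i₀ → ¬((x i : ℝ) ≤ 1 / 2 ↔ (y : ℝ) ≤ 1 / 2))}
  have hsub : crossBall x V ⊆ Set.univ.pi T := by
    rintro y ⟨h1, h2⟩ i -
    refine ⟨exists_abs_le_of_mem_torusBall h1 i, ?_⟩
    rintro rfl h3
    refine h2 ?_
    simp only [halfCube, Set.mem_ofPred_eq]
    exact ⟨fun h _ => h3.1 (h hm), fun h _ => h3.2 (h hm)⟩
  have h0 : volume (T i₀) ≤ ENNReal.ofReal (crossProfile r (x i₀)) := by
    refine (measure_mono ?_).trans (volume_circle_cross_le (x i₀) hr2)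
    exact fun y hy => ⟨hy.1, hy.2 rfl⟩
  have h1 : ∀ i, volume (T i) ≤ ENNReal.ofReal (V ^ (1 / (m : ℝ))) := fun i => by
    refine (measure_mono (fun y hy => hy.1)).trans ((volume_circle_interval_le (x i) r).trans ?_)
    rw [hr]; exact ENNReal.ofReal_le_ofReal (by linarith)
  have h2 : volume (crossBall x V) ≤ ENNReal.ofReal ((V ^ (1 / (m : ℝ))) ^ (m - 1) *
      crossProfile r (x i₀)) := by
    calc volume (crossBall x V) ≤ ∏ i, volume (T i) := by
          rw [← volume_pi_pi]; exact measure_mono hsub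
      _ = volume (T i₀) * ∏ i ∈ Finset.univ.erase i₀, volume (T i) :=
          (Finset.mul_prod_erase _ _ (Finset.mem_univ i₀)).symm
      _ ≤ ENNReal.ofReal (crossProfile r (x i₀)) *
          ∏ i ∈ Finset.univ.erase i₀, ENNReal.ofReal (V ^ (1 / (m : ℝ))) :=
          mul_le_mul' h0 (Finset.prod_le_prod' fun i _ => h1 i)
      _ = _ := by
          rw [Finset.prod_const, Finset.card_erase_of_mem (Finset.mem_univ _), Finset.card_univ,
            Fintype.card_fin, ENNReal.ofReal_mul (by positivity), ENNReal.ofReal_pow hV0, mul_comm]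
  exact ENNReal.toReal_le_of_le_ofReal
    (mul_nonneg (by positivity) (crossProfile_nonneg _ _)) h2

theorem integral_cube_coordinate {m : ℕ} (i : Fin m) {f : ℝ → ℝ} (hf : Continuous f) :
    ∫ x : Cube m, f (x i) = ∫ a in (0 : ℝ)..1, f a := by
  have h1 := measurePreserving_eval (fun _ : Fin m => (volume : Measure unitInterval)) i
  have h2 := integral_map (μ := (volume : Measure (Cube m))) h1.measurable.aemeasurable
    (f := fun a : unitInterval => f a) (by fun_prop)
  rw [volume_pi, h1.map_eq] at h2
  have h3 : ∫ x : Cube m, f (x i) = ∫ a : unitInterval, f a := h2.symm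
  rw [h3, intervalIntegral.integral_of_le zero_le_one, ← integral_Icc_eq_integral_Ioc]
  exact integral_subtype_comap measurableSet_Icc f

end Geometry

/-! ### Concentration of the mean gain -/

section MeanGain

/-- Telescoping: Bernoulli's inequality for `(1 - 1/(K+1)) ^ (1 - α)` bounds each term by an
increment of `K ^ (1 - α) / (1 - α)`. -/
theorem sum_range_rpow_neg_le {α : ℝ} (hα : 0 ≤ α) (hα1 : α < 1) (K : ℕ) :
    ∑ k ∈ Finset.range K, ((k + 1 : ℕ) : ℝ) ^ (-α) ≤ (K : ℝ) ^ (1 - α) / (1 - α) := by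
  induction K with
  | zero => simp [Real.zero_rpow (by linarith : 1 - α ≠ 0)]
  | succ K ih =>
    have h1 : (0 : ℝ) < 1 - α := by linarith
    have hK : (0 : ℝ) < ((K + 1 : ℕ) : ℝ) := by positivity
    have hs : -1 ≤ -(1 / ((K + 1 : ℕ) : ℝ)) := by
      rw [neg_le_neg_iff, div_le_one hK]; exact_mod_cast Nat.le_add_left 1 K
    have h2 := rpow_one_add_le_one_add_mul_self hs h1.le (by linarith : 1 - α ≤ 1)
    have h3 : (K : ℝ) ^ (1 - α) ≤ ((K + 1 : ℕ) : ℝ) ^ (1 - α) -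
        (1 - α) * ((K + 1 : ℕ) : ℝ) ^ (-α) := by
      have e1 : (K : ℝ) = ((K + 1 : ℕ) : ℝ) * (1 + -(1 / ((K + 1 : ℕ) : ℝ))) := by
        field_simp; push_cast; ring
      have e2 : ((K + 1 : ℕ) : ℝ) ^ (-α) = ((K + 1 : ℕ) : ℝ) ^ (1 - α) / ((K + 1 : ℕ) : ℝ) := by
        rw [← Real.rpow_sub_one hK.ne']; congr 1; ring
      rw [e2]
      calc (K : ℝ) ^ (1 - α) = ((K + 1 : ℕ) : ℝ) ^ (1 - α) *
            (1 + -(1 / ((K + 1 : ℕ) : ℝ))) ^ (1 - α) := by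
            conv_lhs => rw [e1]
            exact Real.mul_rpow hK.le (by linarith)
        _ ≤ ((K + 1 : ℕ) : ℝ) ^ (1 - α) * (1 + (1 - α) * -(1 / ((K + 1 : ℕ) : ℝ))) :=
            mul_le_mul_of_nonneg_left h2 (by positivity)
        _ = _ := by ring
    rw [Finset.sum_range_succ]
    refine (add_le_add_left ih _).trans ?_
    rw [← sub_nonneg]
    have : (((K + 1 : ℕ) : ℝ) ^ (1 - α) / (1 - α) -
        ((K : ℝ) ^ (1 - α) / (1 - α) + ((K + 1 : ℕ) : ℝ) ^ (-α))) =
        (((K + 1 : ℕ) : ℝ) ^ (1 - α) - (1 - α) * ((K + 1 : ℕ) : ℝ) ^ (-α) - (K : ℝ) ^ (1 - α)) /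
          (1 - α) := by field_simp; ring
    rw [this]
    exact div_nonneg (by linarith) h1.le

variable {n m : ℕ} {α β : ℝ}

theorem influenceVolume_nonneg (r : ℕ) : 0 ≤ influenceVolume α β n r := by
  unfold influenceVolume; positivity

theorem influenceVolume_le_one (hα : 0 ≤ α) (hβ : 0 ≤ β) (hn : 1 ≤ n) {r : ℕ} (hr : 1 ≤ r) :
    influenceVolume α β n r ≤ 1 := by
  unfold influenceVolume
  exact mul_le_one₀ (Real.rpow_le_one_of_one_le_of_nonpos (by exact_mod_cast hr) (by linarith))
    (by positivity) (Real.rpow_le_one_of_one_le_of_nonpos (by exact_mod_cast hn) (by linarith))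

/-- Used with `x = n` for the total volume and with `x = δ n` for the top ranks. -/
theorem sum_influenceVolume_le (hα : 0 ≤ α) (hα1 : α < 1) {x : ℝ} (hx : 0 ≤ x) :
    ∑ k : Fin n, (if ((k + 1 : ℕ) : ℝ) ≤ x then influenceVolume α β n (k + 1) else 0) ≤
      x ^ (1 - α) / (1 - α) * (n : ℝ) ^ (-β) := by
  rw [Fin.sum_univ_eq_sum_range
    (fun k => if ((k + 1 : ℕ) : ℝ) ≤ x then influenceVolume α β n (k + 1) else 0),
    ← Finset.sum_filter]
  have hsub : (Finset.range n).filter (fun k => ((k + 1 : ℕ) : ℝ) ≤ x) ⊆ Finset.range ⌊x⌋₊ := by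
    intro k hk
    exact Finset.mem_range.2 (Nat.le_floor (Finset.mem_filter.1 hk).2)
  calc _ ≤ ∑ k ∈ Finset.range ⌊x⌋₊, influenceVolume α β n (k + 1) :=
        Finset.sum_le_sum_of_subset_of_nonneg hsub fun _ _ _ => influenceVolume_nonneg _
    _ = (∑ k ∈ Finset.range ⌊x⌋₊, ((k + 1 : ℕ) : ℝ) ^ (-α)) * (n : ℝ) ^ (-β) := by
        rw [Finset.sum_mul]; rfl
    _ ≤ (⌊x⌋₊ : ℝ) ^ (1 - α) / (1 - α) * (n : ℝ) ^ (-β) :=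
        mul_le_mul_of_nonneg_right (sum_range_rpow_neg_le hα hα1 _) (by positivity)
    _ ≤ _ := by
        have := Nat.floor_le hx
        have h1 : 0 < 1 - α := by linarith
        gcongr

/-- The contribution of a node at `x` with influence region of volume `V` to the mean gain is at
most this. -/
noncomputable def crossBound {m : ℕ} (hm : 0 < m) (V : ℝ) (x : Cube m) : ℝ :=
  (V ^ (1 / (m : ℝ))) ^ (m - 1) * crossProfile (V ^ (1 / (m : ℝ)) / 2) (x ⟨0, hm⟩)

theorem rpow_one_div_mem {V : ℝ} (hV : 0 ≤ V) (hV1 : V ≤ 1) :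
    0 ≤ V ^ (1 / (m : ℝ)) ∧ V ^ (1 / (m : ℝ)) ≤ 1 :=
  ⟨Real.rpow_nonneg hV _, Real.rpow_le_one hV hV1 (by positivity)⟩

theorem rpow_one_div_pow_sub_one_mul (hm : 0 < m) {V : ℝ} (hV : 0 ≤ V) :
    (V ^ (1 / (m : ℝ))) ^ (m - 1) * V ^ (1 / (m : ℝ)) = V := by
  rw [← pow_succ, Nat.sub_add_cancel hm, one_div, Real.rpow_inv_natCast_pow hV hm.ne']

theorem crossBound_mem_Icc (hm : 0 < m) {V : ℝ} (hV : 0 ≤ V) (hV1 : V ≤ 1) (x : Cube m) :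
    crossBound hm V x ∈ Set.Icc 0 V := by
  obtain ⟨h0, h1⟩ := rpow_one_div_mem (m := m) hV hV1
  refine ⟨mul_nonneg (by positivity) (crossProfile_nonneg _ _), ?_⟩
  calc crossBound hm V x ≤ (V ^ (1 / (m : ℝ))) ^ (m - 1) * (2 * (V ^ (1 / (m : ℝ)) / 2)) :=
        mul_le_mul_of_nonneg_left (crossProfile_le (by linarith) (by linarith) (x _).2)
          (by positivity)
    _ = V := by
        rw [mul_div_cancel₀ _ two_ne_zero, rpow_one_div_pow_sub_one_mul hm hV]

theorem measurable_crossBound (hm : 0 < m) (V : ℝ) : Measurable (crossBound hm V) := by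
  unfold crossBound
  refine measurable_const.mul ((continuous_crossProfile _).measurable.comp ?_)
  fun_prop

/-- With side `s = V ^ (1 / m)` this is `s ^ (m - 1) · 2 (s / 2) ^ 2`. The extra factor `s` is the
source of the exponential in the theorem. -/
theorem integral_crossBound (hm : 0 < m) {V : ℝ} (hV : 0 ≤ V) (hV1 : V ≤ 1) :
    ∫ x, crossBound hm V x = V * V ^ (1 / (m : ℝ)) / 2 := by
  obtain ⟨h0, h1⟩ := rpow_one_div_mem (m := m) hV hV1
  unfold crossBound
  rw [integral_const_mul, integral_cube_coordinate _ (continuous_crossProfile _),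
    integral_crossProfile (by linarith) (by linarith)]
  have := rpow_one_div_pow_sub_one_mul hm hV
  calc _ = ((V ^ (1 / (m : ℝ))) ^ (m - 1) * V ^ (1 / (m : ℝ))) * V ^ (1 / (m : ℝ)) / 2 := by ring
    _ = _ := by rw [this]

/-- Hoeffding's inequality for functions of independent uniform points. -/
theorem volume_sum_sub_integral_ge_le {U t : ℝ} (hU : 0 ≤ U) (ht : 0 ≤ t)
    {f : Fin n → Cube m → ℝ} (hf : ∀ k, Measurable (f k)) (h : ∀ k x, f k x ∈ Set.Icc 0 U) :
    (volume : Measure (Fin n → Cube m)).real {x | t ≤ ∑ k, (f k (x k) - ∫ y, f k y)} ≤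
      Real.exp (-t ^ 2 / (2 * (n * (U / 2) ^ 2))) := by
  have hsub : ∀ k, HasSubgaussianMGF (fun x : Fin n → Cube m => f k (x k) - ∫ y, f k y)
      ((‖U - 0‖₊ / 2) ^ 2) volume := by
    intro k
    have h1 : AEMeasurable (fun x : Fin n → Cube m => f k (x k)) volume :=
      ((hf k).comp (measurable_pi_apply k)).aemeasurable
    have h2 := hasSubgaussianMGF_of_mem_Icc h1 (.of_forall fun x => h k (x k))
    have h3 : ∫ x : Fin n → Cube m, f k (x k) = ∫ y, f k y := by
      have e := measurePreserving_eval (fun _ : Fin n => (volume : Measure (Cube m))) k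
      rw [← e.map_eq, integral_map e.measurable.aemeasurable (hf k).aestronglyMeasurable]
      rfl
    rwa [h3] at h2
  have hind : iIndepFun (fun k (x : Fin n → Cube m) => f k (x k) - ∫ y, f k y) volume :=
    iIndepFun_pi (X := fun k y => f k y - ∫ y, f k y)
      fun k => ((hf k).sub_const _).aemeasurable
  have := HasSubgaussianMGF.measure_sum_ge_le_of_iIndepFun hind (s := Finset.univ)
    (fun k _ => hsub k) ht
  refine this.trans (le_of_eq ?_)
  simp [abs_of_nonneg hU]

variable [NeZero n] {p : unitInterval} {ρ : Measure (Fin n)} [IsProbabilityMeasure ρ]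

/-- The three summands are the top `δ n` ranks at their full volume, the mean of the other nodes,
and the deviation allowed in Hoeffding's inequality. -/
theorem IsGeoP.measureReal_meanGain_gt_le {π : Measure (State n m)} (h : IsGeoP α β p ρ π)
    (hm : 0 < m) (hα : 0 < α) (hα1 : α < 1) (hβ : 0 < β) {δ : ℝ} (hδ : 0 < δ) :
    π.real {s | p * ((n : ℝ) ^ (1 - α - β) * (δ ^ (1 - α) / (1 - α) +
      (δ ^ (-α) * (n : ℝ) ^ (-(α + β))) ^ (1 / (m : ℝ)) / (2 * (1 - α)) + δ)) <
        meanGain α β p s} ≤ Real.exp (-(2 * δ ^ (2 + 2 * α) * n)) := by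
  classical
  have := h.1
  have hn1 : 1 ≤ n := NeZero.one_le
  have hn : (0 : ℝ) < n := by exact_mod_cast hn1
  have h1α : 0 < 1 - α := by linarith
  set N := (n : ℝ) ^ (1 - α - β) with hN
  set U := δ ^ (-α) * (n : ℝ) ^ (-(α + β)) with hU
  have hN0 : 0 < N := by positivity
  have hU0 : 0 < U := by positivity
  set V : Fin n → ℝ := fun k => influenceVolume α β n (k + 1) with hV
  have hV0 : ∀ k, 0 ≤ V k := fun k => influenceVolume_nonneg _
  have hV1 : ∀ k, V k ≤ 1 := fun k => influenceVolume_le_one hα.le hβ.le hn1 (Nat.le_add_left 1 k)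
  let low : Fin n → Prop := fun k => ((k + 1 : ℕ) : ℝ) ≤ δ * n
  have hVU : ∀ k, ¬ low k → V k ≤ U := by
    intro k hk
    have hk' : δ * n ≤ ((k + 1 : ℕ) : ℝ) := (not_le.1 hk).le
    calc V k = ((k + 1 : ℕ) : ℝ) ^ (-α) * (n : ℝ) ^ (-β) := rfl
      _ ≤ (δ * n) ^ (-α) * (n : ℝ) ^ (-β) := mul_le_mul_of_nonneg_right
          (Real.rpow_le_rpow_of_nonpos (by positivity) hk' (by linarith)) (by positivity)
      _ = U := by
          rw [hU, Real.mul_rpow hδ.le hn.le, mul_assoc, ← Real.rpow_add hn]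
          ring_nf
  -- Removing the top ranks reduces the range of every summand to `[0, U]`; their large balls would
  -- spoil Hoeffding's inequality.
  let f : Fin n → Cube m → ℝ := fun k x => if low k then 0 else crossBound hm (V k) x
  have hf : ∀ k, Measurable (f k) := fun k => by
    by_cases hk : low k
    · simp only [f, if_pos hk]; exact measurable_const
    · simp only [f, if_neg hk]; exact measurable_crossBound hm _
  have hfU : ∀ k x, f k x ∈ Set.Icc 0 U := fun k x => by
    by_cases hk : low k
    · simp only [f, if_pos hk]; exact ⟨le_rfl, hU0.le⟩
    · simp only [f, if_neg hk]
      have := crossBound_mem_Icc hm (hV0 k) (hV1 k) x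
      exact ⟨this.1, this.2.trans (hVU k hk)⟩
  have hmean : ∑ k, ∫ y, f k y ≤ N * (U ^ (1 / (m : ℝ)) / (2 * (1 - α))) := by
    have h1 : ∀ k, ∫ y, f k y ≤ V k * (U ^ (1 / (m : ℝ)) / 2) := by
      intro k
      by_cases hk : low k
      · simp only [f, if_pos hk, integral_zero]
        exact mul_nonneg (hV0 k) (by positivity)
      · simp only [f, if_neg hk]
        rw [integral_crossBound hm (hV0 k) (hV1 k), mul_div_assoc]
        have := Real.rpow_le_rpow (hV0 k) (hVU k hk) (by positivity : 0 ≤ 1 / (m : ℝ))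
        exact mul_le_mul_of_nonneg_left (by linarith) (hV0 k)
    have h2 : ∑ k, V k ≤ N / (1 - α) := by
      have h3 := sum_influenceVolume_le (n := n) (β := β) hα.le hα1 hn.le
      have h4 : (n : ℝ) ^ (1 - α) / (1 - α) * (n : ℝ) ^ (-β) = N / (1 - α) := by
        rw [hN, div_mul_eq_mul_div, ← Real.rpow_add hn]; ring_nf
      rw [h4] at h3
      refine le_trans (le_of_eq (Finset.sum_congr rfl fun k _ => ?_)) h3
      rw [if_pos]
      exact_mod_cast k.isLt
    calc ∑ k, ∫ y, f k y ≤ ∑ k, V k * (U ^ (1 / (m : ℝ)) / 2) := Finset.sum_le_sum fun k _ => h1 k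
      _ = (∑ k, V k) * (U ^ (1 / (m : ℝ)) / 2) := by rw [Finset.sum_mul]
      _ ≤ N / (1 - α) * (U ^ (1 / (m : ℝ)) / 2) := mul_le_mul_of_nonneg_right h2 (by positivity)
      _ = _ := by field_simp
  have hlow : ∑ k, (if low k then V k else 0) ≤ N * (δ ^ (1 - α) / (1 - α)) := by
    refine (sum_influenceVolume_le (n := n) (β := β) hα.le hα1
      (by positivity : 0 ≤ δ * n)).trans (le_of_eq ?_)
    rw [Real.mul_rpow hδ.le hn.le, hN, show 1 - α - β = (1 - α) + (-β) by ring, Real.rpow_add hn]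
    ring
  have hgain : ∀ s : State n m, meanGain α β p s ≤
      p * (∑ k, (if low k then V k else 0) + ∑ k, f k (s.1 k)) := by
    intro s
    refine mul_le_mul_of_nonneg_left ?_ p.2.1
    rw [← Finset.sum_add_distrib]
    refine Finset.sum_le_sum fun k _ => ?_
    have h1 := volume_crossBall_le hm (s.1 k) (hV0 k) (hV1 k)
    have h2 := crossBound_mem_Icc hm (hV0 k) (hV1 k) (s.1 k)
    by_cases hk : low k
    · simp only [f, if_pos hk, add_zero]
      exact h1.trans h2.2
    · simp only [f, if_neg hk, zero_add]
      exact h1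
  have hsub : {s : State n m | p * (N * (δ ^ (1 - α) / (1 - α) + U ^ (1 / (m : ℝ)) /
      (2 * (1 - α)) + δ)) < meanGain α β p s} ⊆
      Prod.fst ⁻¹' {x | N * δ ≤ ∑ k, (f k (x k) - ∫ y, f k y)} := by
    intro s hs
    have h1 : (p : ℝ) * _ < p * _ := lt_of_lt_of_le hs (hgain s)
    have h2 := lt_of_mul_lt_mul_left h1 p.2.1
    simp only [Set.mem_preimage, Set.mem_ofPred_eq, Finset.sum_sub_distrib]
    linarith
  have hB : MeasurableSet {x : Fin n → Cube m | N * δ ≤ ∑ k, (f k (x k) - ∫ y, f k y)} := by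
    refine measurableSet_le measurable_const (Finset.measurable_fun_sum _ fun k _ => ?_)
    exact ((hf k).comp (measurable_pi_apply k)).sub_const _
  calc _ ≤ π.real (Prod.fst ⁻¹' {x | N * δ ≤ ∑ k, (f k (x k) - ∫ y, f k y)}) :=
        measureReal_mono hsub
    _ = (volume : Measure (Fin n → Cube m)).real
          {x | N * δ ≤ ∑ k, (f k (x k) - ∫ y, f k y)} := by
        rw [← h.map_fst, map_measureReal_apply measurable_fst hB]
    _ ≤ Real.exp (-(N * δ) ^ 2 / (2 * (n * (U / 2) ^ 2))) :=
        volume_sum_sub_integral_ge_le hU0.le (by positivity) hf hfU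
    -- Since `N = n · n^(-(α+β))`, the powers of `n` in `N` and `U` cancel up to a single factor
    -- `n`.
    _ = Real.exp (-(2 * δ ^ (2 + 2 * α) * n)) := by
        congr 1
        have e1 : δ ^ (2 + 2 * α) = δ ^ 2 / (δ ^ (-α)) ^ 2 := by
          rw [← Real.rpow_natCast (δ ^ (-α)), ← Real.rpow_mul hδ.le, ← Real.rpow_natCast δ,
            ← Real.rpow_sub hδ]
          congr 1; push_cast; ring
        have e2 : N = n * (n : ℝ) ^ (-(α + β)) := by
          rw [hN, show 1 - α - β = 1 + -(α + β) by ring, Real.rpow_add hn, Real.rpow_one]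
        have e3 : (0 : ℝ) < (n : ℝ) ^ (-(α + β)) := by positivity
        have e4 : 0 < δ ^ (-α) := by positivity
        rw [e1, e2, hU]
        field_simp

end MeanGain

/-! ### Asymptotic estimates -/

section Asymptotics

/-- Turns a bound for every fixed `ε` into one with a null sequence, by taking for each `n` nearly
the least admissible error. -/
theorem exists_tendsto_zero_of_eventually {P : ℕ → ℝ → Prop}
    (hmono : ∀ n a b, a ≤ b → P n a → P n b) (h : ∀ ε > 0, ∀ᶠ n in atTop, P n ε) :
    ∃ ε : ℕ → ℝ, Tendsto ε atTop (𝓝 0) ∧ ∀ᶠ n in atTop, P n (ε n) := by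
  let S : ℕ → Set ℝ := fun n => {e | 0 < e ∧ P n e}
  have hbdd : ∀ n, BddBelow (S n) := fun n => ⟨0, fun e he => he.1.le⟩
  -- The infimum need not be admissible, so a vanishing amount is added.
  refine ⟨fun n => sInf (S n) + 1 / ((n : ℝ) + 1), ?_, ?_⟩
  · have h1 : Tendsto (fun n => sInf (S n)) atTop (𝓝 0) := by
      refine tendsto_order.2 ⟨fun a ha => .of_forall fun n =>
        ha.trans_le (Real.sInf_nonneg fun e he => he.1.le), fun a ha => ?_⟩
      filter_upwards [h (a / 2) (half_pos ha)] with n hn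
      exact (csInf_le (hbdd n) ⟨half_pos ha, hn⟩).trans_lt (half_lt_self ha)
    simpa using h1.add tendsto_one_div_add_atTop_nhds_zero_nat
  · filter_upwards [h 1 one_pos] with n hn
    have h2 : sInf (S n) < sInf (S n) + 1 / ((n : ℝ) + 1) := by
      have : 0 < 1 / ((n : ℝ) + 1) := by positivity
      linarith
    obtain ⟨e, he, hlt⟩ := exists_lt_of_csInf_lt (⟨1, one_pos, hn⟩ : (S n).Nonempty) h2
    exact hmono n _ _ hlt.le he.2

theorem eventually_log_le_rpow {c θ : ℝ} (hc : 0 < c) (hθ : 0 < θ) (a : ℝ) :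
    ∀ᶠ n : ℕ in atTop, a + 3 * Real.log n + Real.log n ^ 2 ≤ c * (n : ℝ) ^ θ := by
  have h0 : (fun _ : ℝ => a) =o[atTop] fun x : ℝ => x ^ θ :=
    isLittleO_const_left.2 (Or.inr (tendsto_norm_atTop_atTop.comp (tendsto_rpow_atTop hθ)))
  have h1 : (fun x : ℝ => 3 * Real.log x) =o[atTop] fun x : ℝ => x ^ θ :=
    (isLittleO_log_rpow_atTop hθ).const_mul_left 3
  have h2 : (fun x : ℝ => Real.log x ^ 2) =o[atTop] fun x : ℝ => x ^ θ := by
    simpa using isLittleO_log_rpow_rpow_atTop 2 hθ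
  have h3 := ((h0.add h1).add h2).bound hc
  filter_upwards [tendsto_natCast_atTop_atTop.eventually h3] with n hn
  rw [Real.norm_of_nonneg (by positivity : (0 : ℝ) ≤ (n : ℝ) ^ θ)] at hn
  exact (le_abs_self _).trans hn

theorem eventually_rpow_one_sub_le {c θ : ℝ} (hc : 0 < c) (hθ : 0 < θ) :
    ∀ᶠ n : ℕ in atTop, (n : ℝ) ^ (1 - θ) ≤ c * n := by
  have h1 : Tendsto (fun n : ℕ => (n : ℝ) ^ (-θ)) atTop (𝓝 0) :=
    (tendsto_rpow_neg_atTop hθ).comp tendsto_natCast_atTop_atTop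
  filter_upwards [h1.eventually (gt_mem_nhds hc), eventually_gt_atTop 0] with n hn hn0
  have hn0' : (0 : ℝ) < n := Nat.cast_pos.2 hn0
  rw [sub_eq_add_neg, Real.rpow_add hn0', Real.rpow_one, mul_comm]
  exact mul_le_mul_of_nonneg_right hn.le hn0'.le

/-- Each of the three terms is eventually at most a third of the right side; in the second, `n ^ (1
- θ)` uses up half of `c' n`. -/
theorem eventually_tail_le {c c' θ C C' : ℝ} (hc : 0 < c) (hc' : 0 < c') (hθ : 0 < θ)
    (hC : 0 < C) (hC' : 0 < C') :
    ∀ᶠ n : ℕ in atTop, C * Real.exp (-(c * (n : ℝ) ^ θ)) +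
      C' * (n : ℝ) ^ 2 * Real.exp ((n : ℝ) ^ (1 - θ)) * Real.exp (-(c' * n)) +
      Real.exp (-(c' * n)) ≤ Real.exp (-1 * Real.log n ^ 2) := by
  have hc2 : 0 < c' / 2 := half_pos hc'
  filter_upwards [eventually_log_le_rpow hc hθ (Real.log (3 * C)),
    eventually_log_le_rpow hc2 one_pos (Real.log (3 * C')),
    eventually_log_le_rpow hc2 one_pos (Real.log 3), eventually_rpow_one_sub_le hc2 hθ,
    eventually_ge_atTop 1] with n h1 h2 h3 h4 hn
  have hn0 : (0 : ℝ) < n := by exact_mod_cast hn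
  have hlog : 0 ≤ Real.log n := Real.log_natCast_nonneg n
  rw [Real.rpow_one] at h2 h3
  have e1 : C * Real.exp (-(c * (n : ℝ) ^ θ)) ≤ Real.exp (-1 * Real.log n ^ 2) / 3 := by
    rw [le_div_iff₀ (by norm_num)]
    calc _ = Real.exp (Real.log (3 * C)) * Real.exp (-(c * (n : ℝ) ^ θ)) := by
          rw [Real.exp_log (by positivity)]; ring
      _ ≤ _ := by
          rw [← Real.exp_add]
          exact Real.exp_le_exp.2 (by linarith)
  have e2 : C' * (n : ℝ) ^ 2 * Real.exp ((n : ℝ) ^ (1 - θ)) * Real.exp (-(c' * n)) ≤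
      Real.exp (-1 * Real.log n ^ 2) / 3 := by
    rw [le_div_iff₀ (by norm_num)]
    calc _ = Real.exp (Real.log (3 * C')) * Real.exp (2 * Real.log n) *
          Real.exp ((n : ℝ) ^ (1 - θ)) * Real.exp (-(c' * n)) := by
          rw [Real.exp_log (by positivity), show 2 * Real.log n = Real.log n + Real.log n by ring,
            Real.exp_add, Real.exp_log hn0]
          ring
      _ ≤ _ := by
          rw [← Real.exp_add, ← Real.exp_add, ← Real.exp_add]
          exact Real.exp_le_exp.2 (by linarith)
  have e3 : Real.exp (-(c' * n)) ≤ Real.exp (-1 * Real.log n ^ 2) / 3 := by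
    rw [le_div_iff₀ (by norm_num)]
    calc _ = Real.exp (-(c' * n)) * Real.exp (Real.log 3) := by
          rw [Real.exp_log (by norm_num)]
      _ ≤ _ := by
          rw [← Real.exp_add]
          exact Real.exp_le_exp.2 (by nlinarith)
  linarith

end Asymptotics

/-! ### The cut bound for a given limit of the side lengths -/

/-- The cut of `GEO-P(α,β,m,p)` is at most `(p b / (4 (1 - α)) + ε) n^{2-α-β}` with probability
`1 - exp(-log² n)` if the side lengths of the typical influence regions tend to `b`. -/
theorem eventually_measureReal_cutSize_le {α β : ℝ} (hα : 0 < α) (hβ : 0 < β) (hβ1 : β < 1 - α)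
    {p : unitInterval} {m : ℕ → ℕ} (hm : ∀ n, 0 < m n) {ρ : ∀ n, Measure (Fin n)}
    (hρ : ∀ n, 0 < n → IsProbabilityMeasure (ρ n)) {π : ∀ n, Measure (State n (m n))}
    (hπ : ∀ n, 0 < n → IsGeoP α β p (ρ n) (π n)) {b : ℝ} (hb : 0 ≤ b)
    (hside : ∀ δ : ℝ, 0 < δ → Tendsto (fun n : ℕ =>
      (δ ^ (-α) * (n : ℝ) ^ (-(α + β))) ^ (1 / (m n : ℝ))) atTop (𝓝 b)) {ε : ℝ} (hε : 0 < ε) :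
    ∀ᶠ n : ℕ in atTop, 1 - Real.exp (-1 * Real.log n ^ 2) ≤
      (π n).real {s | (cutSize s : ℝ) ≤ (p / (4 * (1 - α)) * b + ε) * (n : ℝ) ^ (2 - α - β)} := by
  have hα1 : α < 1 := by linarith
  have h1α : 0 < 1 - α := by linarith
  -- This splits the exponent evenly: `κ = n ^ (-θ)` tends to `0`, while `lam` times a deviation of
  -- order `n ^ (2 - α - β)` still grows like `n ^ θ`.
  set θ := (1 - α - β) / 2 with hθ
  have hθ0 : 0 < θ := by rw [hθ]; linarith
  obtain ⟨δ, hδ, hδε⟩ : ∃ δ : ℝ, 0 < δ ∧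
      δ ^ (1 - α) / (1 - α) + δ / (2 * (1 - α)) + δ ≤ ε := by
    have h1 : Tendsto (fun δ : ℝ => δ ^ (1 - α) / (1 - α) + δ / (2 * (1 - α)) + δ) (𝓝 0) (𝓝 0) := by
      have : ContinuousAt (fun δ : ℝ => δ ^ (1 - α) / (1 - α) + δ / (2 * (1 - α)) + δ) 0 :=
        (((Real.continuousAt_rpow_const _ _ (Or.inr h1α.le)).div_const _).add
          (continuousAt_id.div_const _)).add continuousAt_id
      have h2 := this.tendsto
      simpa [Real.zero_rpow h1α.ne'] using h2
    have h2 := (h1.eventually (gt_mem_nhds hε)).filter_mono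
      (nhdsWithin_le_nhds : 𝓝[>] (0 : ℝ) ≤ 𝓝 0)
    obtain ⟨δ, h3, h4⟩ := (h2.and self_mem_nhdsWithin).exists
    exact ⟨δ, h4, h3.le⟩
  set K := (p : ℝ) / (4 * (1 - α)) * b with hK
  have hp0 := p.2.1
  have hp1 := p.2.2
  have hK0 : 0 ≤ K := by positivity
  have hκ : Tendsto (fun n : ℕ => (n : ℝ) ^ (-θ)) atTop (𝓝 0) :=
    (tendsto_rpow_neg_atTop hθ0).comp tendsto_natCast_atTop_atTop
  have hratio : Tendsto (fun n : ℕ => (K + ε / 2) * ((1 + (n : ℝ) ^ (-θ)) / (1 - (n : ℝ) ^ (-θ))))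
      atTop (𝓝 (K + ε / 2)) := by
    have := ((hκ.const_add 1).div (hκ.const_sub 1) (by norm_num)).const_mul (K + ε / 2)
    simpa using this
  have hε4 : 0 < ε / 4 := by linarith
  filter_upwards [eventually_tail_le (c := ε / 4) (c' := 2 * δ ^ (2 + 2 * α)) (θ := θ)
      (C := (K + 3 * ε / 4) / (ε / 4)) (C' := 2 / (ε / 4)) hε4 (by positivity) hθ0 (by positivity)
      (by positivity),
    hκ.eventually (gt_mem_nhds (show (0 : ℝ) < 1 / 2 by norm_num)),
    hratio.eventually (gt_mem_nhds (show K + ε / 2 < K + 3 * ε / 4 by linarith)),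
    (hside δ hδ).eventually (gt_mem_nhds (show b < b + δ by linarith)),
    eventually_gt_atTop 0] with n htail hκn hrat hBn hn0
  have : NeZero n := ⟨hn0.ne'⟩
  have := hρ n hn0
  have hG := hπ n hn0
  have := hG.1
  have hn : (0 : ℝ) < n := Nat.cast_pos.2 hn0
  have hn1 : (1 : ℝ) ≤ n := by exact_mod_cast hn0
  set κ := (n : ℝ) ^ (-θ) with hκdef
  have hκ0 : 0 < κ := by positivity
  set N := (n : ℝ) ^ (1 - α - β) with hN
  set M := (n : ℝ) ^ (2 - α - β) with hM
  have hN0 : 0 < N := by positivity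
  have hM0 : 0 < M := by positivity
  have hMN : M = N * n := by
    rw [hM, hN, show 2 - α - β = (1 - α - β) + 1 by ring, Real.rpow_add hn, Real.rpow_one]
  have hM1 : 1 ≤ M := Real.one_le_rpow hn1 (by linarith)
  set lam := (n : ℝ) ^ (-1 - θ) with hlam
  have hlam0 : 0 < lam := by positivity
  have hlamn : κ = lam * n := by
    rw [hκdef, hlam, ← Real.rpow_add_one hn.ne']; congr 1; ring
  have hlamn2 : lam * (n : ℝ) ^ 2 = (n : ℝ) ^ (1 - θ) := by
    rw [hlam, ← Real.rpow_natCast, ← Real.rpow_add hn]; congr 1; push_cast; ring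
  have hlamM : lam * (ε / 4 * M) = ε / 4 * (n : ℝ) ^ θ := by
    rw [hlam, hM, mul_left_comm, ← Real.rpow_add hn]
    congr 2
    rw [hθ]; ring
  -- The error budget: `ε` in `g` becomes `ε / 2` in `x`, the ratio in `κ` raises it to `3 ε / 4`,
  -- and `η` adds the last `ε / 4`.
  set g := N * (2 * K + ε) with hg
  set x := M * ((K + ε / 2) * ((1 + κ) / (1 - κ))) with hx
  have hκ1 : 0 < 1 - κ := by linarith
  have hbad : (π n).real {s | g < meanGain α β p s} ≤
      Real.exp (-(2 * δ ^ (2 + 2 * α) * n)) := by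
    refine (measureReal_mono fun s hs => ?_).trans
      (hG.measureReal_meanGain_gt_le (hm n) hα hα1 hβ hδ)
    have hs' : g < meanGain α β p s := hs
    refine lt_of_le_of_lt ?_ hs'
    rw [mul_left_comm, hg]
    refine mul_le_mul_of_nonneg_left ?_ hN0.le
    set B := (δ ^ (-α) * (n : ℝ) ^ (-(α + β))) ^ (1 / (m n : ℝ)) with hB
    have h1 : B / (2 * (1 - α)) ≤ b / (2 * (1 - α)) + δ / (2 * (1 - α)) := by
      rw [← add_div]; exact div_le_div_of_nonneg_right hBn.le (by positivity)
    have h2 : (p : ℝ) * (b / (2 * (1 - α))) = 2 * K := by rw [hK]; field_simp; ring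
    calc (p : ℝ) * (δ ^ (1 - α) / (1 - α) + B / (2 * (1 - α)) + δ)
        ≤ p * (b / (2 * (1 - α)) + ε) := mul_le_mul_of_nonneg_left (by linarith) hp0
      _ = 2 * K + p * ε := by rw [mul_add, h2]
      _ ≤ 2 * K + ε := by nlinarith
  have htailn := hG.measureReal_cutSum_ge_le (lam := lam) (κ := κ) (g := g) (x := x)
    (η := ε / 4 * M) hlam0 hlamn hκn.le (by positivity)
    (by rw [hg, hx, hMN]; field_simp) (by positivity) hbad
  rw [hlamM, hlamn2] at htailn
  have hxη : x + ε / 4 * M ≤ (K + ε) * M := by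
    have h1 : x ≤ M * (K + 3 * ε / 4) := mul_le_mul_of_nonneg_left hrat.le hM0.le
    linarith
  have hx1 : x / (ε / 4 * M) ≤ (K + 3 * ε / 4) / (ε / 4) := by
    rw [hx, mul_comm (ε / 4) M, mul_div_mul_left _ _ hM0.ne']
    exact div_le_div_of_nonneg_right hrat.le hε4.le
  have hM2 : 2 * (n : ℝ) ^ 2 / (ε / 4 * M) ≤ 2 / (ε / 4) * (n : ℝ) ^ 2 := by
    rw [div_mul_eq_mul_div (2 : ℝ) (ε / 4) ((n : ℝ) ^ 2)]
    exact div_le_div_of_nonneg_left (by positivity) hε4 (le_mul_of_one_le_right hε4.le hM1)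
  have hle : (π n).real {s | x + ε / 4 * M ≤ cutSum s} ≤ Real.exp (-1 * Real.log n ^ 2) := by
    refine htailn.trans (le_trans ?_ htail)
    gcongr
  have hcompl : 1 ≤ (π n).real {s | (cutSize s : ℝ) ≤ (K + ε) * M} +
      (π n).real {s | x + ε / 4 * M ≤ cutSum s} := by
    have huniv : (Set.univ : Set (State n (m n))) ⊆
        {s | (cutSize s : ℝ) ≤ (K + ε) * M} ∪ {s | x + ε / 4 * M ≤ cutSum s} := by
      intro s _
      rcases le_total (x + ε / 4 * M) (cutSum s) with h | h
      · exact Or.inr h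
      · exact Or.inl ((cutSize_le_cutSum s).trans (h.trans hxη))
    have := (measureReal_mono (μ := π n) huniv).trans (measureReal_union_le _ _)
    rwa [probReal_univ] at this
  linarith

/-! ### Limits of the side lengths -/

section SideLength

variable {α β : ℝ} {m : ℕ → ℕ}

theorem side_eventuallyEq {δ : ℝ} (hδ : 0 < δ) :
    (fun n : ℕ => Real.exp (-α * Real.log δ * (m n : ℝ)⁻¹ -
      (α + β) * (Real.log n * (m n : ℝ)⁻¹))) =ᶠ[atTop]
    fun n : ℕ => (δ ^ (-α) * (n : ℝ) ^ (-(α + β))) ^ (1 / (m n : ℝ)) := by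
  filter_upwards [eventually_gt_atTop 0] with n hn
  have hn : (0 : ℝ) < n := Nat.cast_pos.2 hn
  rw [Real.rpow_def_of_pos hδ, Real.rpow_def_of_pos hn, ← Real.exp_add, ← Real.exp_mul]
  congr 1
  ring

/-- In the exponent `log n / m → ∞` dominates; the term with `log δ` stays bounded as `m ≥ 1`. -/
theorem tendsto_side_of_isLittleO (hα : 0 < α) (hβ : 0 < β) (hm : ∀ n, 0 < m n)
    (h : (fun n => (m n : ℝ)) =o[atTop] fun n : ℕ => Real.log n) {δ : ℝ} (hδ : 0 < δ) :
    Tendsto (fun n : ℕ => (δ ^ (-α) * (n : ℝ) ^ (-(α + β))) ^ (1 / (m n : ℝ))) atTop (𝓝 0) := by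
  refine (Real.tendsto_exp_atBot.comp ?_).congr' (side_eventuallyEq hδ)
  have h1 : Tendsto (fun n : ℕ => Real.log n * (m n : ℝ)⁻¹) atTop atTop := by
    have h2 : Tendsto (fun n : ℕ => (m n : ℝ) / Real.log n) atTop (𝓝[>] 0) := by
      refine tendsto_nhdsWithin_iff.2 ⟨h.tendsto_div_nhds_zero, ?_⟩
      filter_upwards [eventually_gt_atTop 1] with n hn
      exact div_pos (Nat.cast_pos.2 (hm n)) (Real.log_pos (by exact_mod_cast hn))
    refine h2.inv_tendsto_nhdsGT_zero.congr fun n => ?_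
    simp [div_eq_mul_inv]
  refine tendsto_atBot_mono (fun n => ?_) (tendsto_atBot_add_const_left _ |-α * Real.log δ|
    (tendsto_neg_atTop_atBot.comp (h1.const_mul_atTop (show 0 < α + β by linarith))))
  have h3 : (m n : ℝ)⁻¹ ≤ 1 := inv_le_one_of_one_le₀ (by exact_mod_cast hm n)
  have h4 : (0 : ℝ) ≤ (m n : ℝ)⁻¹ := by positivity
  have h5 : -α * Real.log δ * (m n : ℝ)⁻¹ ≤ |-α * Real.log δ| * 1 :=
    mul_le_mul (le_abs_self _) h3 h4 (abs_nonneg _)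
  simp only [Function.comp_apply]
  linarith

/-- Here `m → ∞`, so the contribution of `δ` vanishes and `log n / m → 1 / C` gives the limit. -/
theorem tendsto_side_of_tendsto {C : ℝ} (hC : 0 < C)
    (h : Tendsto (fun n : ℕ => (m n : ℝ) / Real.log n) atTop (𝓝 C)) {δ : ℝ} (hδ : 0 < δ) :
    Tendsto (fun n : ℕ => (δ ^ (-α) * (n : ℝ) ^ (-(α + β))) ^ (1 / (m n : ℝ))) atTop
      (𝓝 (Real.exp (-(α + β) / C))) := by
  refine ((Real.continuous_exp.tendsto _).comp ?_).congr' (side_eventuallyEq hδ)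
  have h1 : Tendsto (fun n : ℕ => Real.log n * (m n : ℝ)⁻¹) atTop (𝓝 C⁻¹) := by
    refine (h.inv₀ hC.ne').congr fun n => ?_
    rw [inv_div, div_eq_mul_inv]
  have hlog : Tendsto (fun n : ℕ => Real.log n) atTop atTop :=
    Real.tendsto_log_atTop.comp tendsto_natCast_atTop_atTop
  have h2 : Tendsto (fun n : ℕ => (m n : ℝ)⁻¹) atTop (𝓝 0) := by
    have h3 := h1.mul (tendsto_inv_atTop_zero.comp hlog)
    rw [mul_zero] at h3
    refine h3.congr' ?_
    filter_upwards [eventually_gt_atTop 1] with n hn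
    have : Real.log n ≠ 0 := (Real.log_pos (by exact_mod_cast hn)).ne'
    simp only [Function.comp_apply]
    field_simp
  have h3 := (h2.const_mul (-α * Real.log δ)).sub (h1.const_mul (α + β))
  convert h3 using 2
  rw [mul_zero, zero_sub, neg_div, div_eq_mul_inv]

end SideLength

end GeoProtean

/-! ### The theorem -/

open GeoProtean in
theorem theorem4p5 (α β : ℝ) (hα : 0 < α) (hα1 : α < 1) (hβ : 0 < β) (hβ1 : β < 1 - α)
    (p : unitInterval) (hp : 0 < p) (m : ℕ → ℕ) (hm : ∀ n, 0 < m n)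
    (ρ : ∀ n, Measure (Fin n)) (hρ : ∀ n, 0 < n → IsProbabilityMeasure (ρ n)) :
    (∀ n, 0 < n → ∃! π : Measure (State n (m n)), IsGeoP α β p (ρ n) π) ∧
    ∀ π : ∀ n, Measure (State n (m n)), (∀ n, 0 < n → IsGeoP α β p (ρ n) (π n)) →
      ((fun n => (m n : ℝ)) =o[atTop] (fun n : ℕ => Real.log n) →
        ∃ ε : ℕ → ℝ, Tendsto ε atTop (𝓝 0) ∧
          WithExtremeProbability π fun n =>
            {s | (cutSize s : ℝ) ≤ ε n * (n : ℝ) ^ (2 - α - β)}) ∧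
      (∀ C : ℝ, 0 < C → Tendsto (fun n : ℕ => (m n : ℝ) / Real.log n) atTop (𝓝 C) →
        ∃ ε : ℕ → ℝ, Tendsto ε atTop (𝓝 0) ∧
          WithExtremeProbability π fun n =>
            {s | (cutSize s : ℝ) ≤ (1 + ε n) * ((p : ℝ) / (4 * (1 - α))) *
              (n : ℝ) ^ (2 - α - β) * Real.exp (-(α + β) / C)}) := by
  refine ⟨fun n hn => ?_, fun π hπ => ⟨fun ho => ?_, fun C hC hlim => ?_⟩⟩
  · have : NeZero n := ⟨hn.ne'⟩
    have := hρ n hn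
    obtain ⟨π, hπ⟩ := exists_isGeoP (m := m n) α β p (ρ n)
    exact ⟨π, hπ, fun π' hπ' => hπ'.unique hπ⟩
  · obtain ⟨ε, hε, hP⟩ := exists_tendsto_zero_of_eventually
      (P := fun n e => 0 < n → 1 - Real.exp (-1 * Real.log n ^ 2) ≤
        (π n).real {s | (cutSize s : ℝ) ≤ e * (n : ℝ) ^ (2 - α - β)})
      (fun n a b hab h hn => by
        have := (hπ n hn).1
        refine (h hn).trans (measureReal_mono fun s hs => ?_)
        exact le_trans hs (mul_le_mul_of_nonneg_right hab (by positivity)))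
      (fun e he => by
        filter_upwards [eventually_measureReal_cutSize_le hα hβ hβ1 hm hρ hπ le_rfl
          (fun δ hδ => tendsto_side_of_isLittleO hα hβ hm ho hδ) he] with n hn _
        simpa using hn)
    refine ⟨ε, hε, 1, one_pos, ?_⟩
    filter_upwards [hP, eventually_gt_atTop 0] with n hn hn0 using hn hn0
  -- As the leading constant is positive, a relative error `e` is an absolute error of `e` times
  -- that constant.
  · have hp' : (0 : ℝ) < p := hp
    have h1α : 0 < 1 - α := by linarith
    have hK : 0 < (p : ℝ) / (4 * (1 - α)) * Real.exp (-(α + β) / C) := by positivity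
    obtain ⟨ε, hε, hP⟩ := exists_tendsto_zero_of_eventually
      (P := fun n e => 0 < n → 1 - Real.exp (-1 * Real.log n ^ 2) ≤
        (π n).real {s | (cutSize s : ℝ) ≤ (1 + e) * ((p : ℝ) / (4 * (1 - α))) *
          (n : ℝ) ^ (2 - α - β) * Real.exp (-(α + β) / C)})
      (fun n a b hab h hn => by
        have := (hπ n hn).1
        refine (h hn).trans (measureReal_mono fun s hs => ?_)
        have hs' : (cutSize s : ℝ) ≤ _ := hs
        refine hs'.trans ?_
        gcongr)
      (fun e he => by
        filter_upwards [eventually_measureReal_cutSize_le hα hβ hβ1 hm hρ hπ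
          (Real.exp_pos (-(α + β) / C)).le (fun δ hδ => tendsto_side_of_tendsto hC hlim hδ)
          (mul_pos he hK)] with n hn _
        refine hn.trans (le_of_eq (congrArg _ (congrArg _ (funext fun s => ?_))))
        rw [eq_iff_iff, show ∀ y : ℝ, ((p : ℝ) / (4 * (1 - α)) * Real.exp (-(α + β) / C) +
          e * ((p : ℝ) / (4 * (1 - α)) * Real.exp (-(α + β) / C))) * y =
          (1 + e) * ((p : ℝ) / (4 * (1 - α))) * y * Real.exp (-(α + β) / C) from fun y => by ring])
    refine ⟨ε, hε, 1, one_pos, ?_⟩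
    filter_upwards [hP, eventually_gt_atTop 0] with n hn hn0 using hn hn0
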